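/- Let $\mu,\lambda>0$, $0<e<1/\sqrt2$ and $a=\lambda^2/\mu$. The Keplerian dynamical system is the planar system $\dot{\mathbf x}=\mathbf b(\mathbf x)$, $\mathbf x=(x,y)$, $r=\sqrt{x^2+y^2}$, with $$b_x=\frac{\mu}{2\lambda}\Big\{\frac{\alpha+\beta-1}{e}-(\alpha+\beta+1)\frac{x}{r}\Big\},\qquad b_y=\frac{\mu}{2\lambda}\Big\{(\alpha-\beta-1)\frac{\sqrt{1-e^2}}{e}-(\alpha+\beta+1)\frac{y}{r}\Big\},$$ where, writing $D=(er-x)^2+(1-e^2)y^2$, $$\alpha=\left(\frac12\sqrt{\frac{(er-x-4ae)^2+(1-e^2)y^2}{D}}+\frac12\,\frac{(er-x-2ae)^2+(1-e^2)y^2-4a^2e^2}{D}\right)^{1/2},\qquad \beta=\frac{-2ae\sqrt{1-e^2}\,y}{D\,\alpha}.$$ These formulas are meaningful off the segment $\{(x,0):-4ae/(1+e)\le x\le 0\}$. For $-e<c<1$ let $\mathcal E_c$ be the ellipse with foci $(0,0)$ and $(-4aec/(e+c),0)$ and semi-major axis $2ae/(e+c)$ (so its eccentricity is $|c|$); $\mathcal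 E_e$ is the Kepler ellipse. Put $\tilde e=\dfrac{-2\sqrt2+3e}{-3+2\sqrt2\,e}$, so that $e<\tilde e<1$. Let $t_0\in\mathbb R$ and let $\mathbf x_0$ lie in the open exterior of $\mathcal E_{\tilde e}$. Then the system has a solution $\mathbf x(t)$ on $[t_0,\infty)$ with $\mathbf x(t_0)=\mathbf x_0$; it stays in the exterior of $\mathcal E_{\tilde e}$ (hence off the segment above), and every solution on an interval $[t_0,T)$ starting at $\mathbf x_0$ coincides with it there. Moreover every solution on $[t_0,\infty)$ starting at $\mathbf x_0$ settles down in the infinite-time limit to Keplerian motion on $\mathcal E_e$, that is: there is a solution $\mathbf y:\mathbb R\to\mathbb R^2$ of the same system such that - $\mathbf y$ traverses exactly $\mathcal E_e$ and obeys Kepler's laws with force constant $\mu$ and energy $-\mu/2a$: $\ddot{\mathbf y}=-\mu\mathbf y/|\mathbf y|^3$; $\tfrac12|\dot{\mathbf y}|^2-\mu/|\mathbf y|=-\mu/(2a)$; $y_1\dot y_2-y_2\dot y_1=\sqrt{\mu a(1-e^2)}$; and $\mathbf y(s)=\mathbf y(t)$ if and only if $s-t$ is an integer multiple of $2\pi\sqrt{a^3/\mu}$;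 - $|\mathbf x(t)-\mathbf y(t)|\to0$ and $|\dot{\mathbf x}(t)-\dot{\mathbf y}(t)|\to0$ as $t\to\infty$. -/

import Mathlib

open Set Filter Topology

noncomputable section

namespace KeplerFlow

/-- The Euclidean plane. -/
abbrev Plane : Type := EuclideanSpace ℝ (Fin 2)

/-- The semi-major axis `a = lam ^ 2 / μ` of the Kepler ellipse. -/
def semiMajor (μ lam : ℝ) : ℝ := lam ^ 2 / μ

/-- The semi-major axis `2 a e / (e + c)` of the ellipse of parameter `c`. -/
def ellipseAxis (a e c : ℝ) : ℝ := 2 * a * e / (e + c)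

/-- The second focus `(-4 a e c / (e + c), 0)` of the ellipse of parameter `c`; the first focus
is the origin. -/
def ellipseFocus (a e c : ℝ) : Plane := !₂[-(4 * a * e * c / (e + c)), 0]

/-- The ellipse of parameter `c`, `-e < c < 1`: foci `(0, 0)` and `(-4 a e c / (e + c), 0)`,
semi-major axis `2 a e / (e + c)`, hence eccentricity `|c|`. -/
def ellipse (a e c : ℝ) : Set Plane :=
  {p | dist p 0 + dist p (ellipseFocus a e c) = 2 * ellipseAxis a e c}

/-- The open exterior of the ellipse of parameter `c`. -/
def ellipseExt (a e c : ℝ) : Set Plane :=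
  {p | 2 * ellipseAxis a e c < dist p 0 + dist p (ellipseFocus a e c)}

/-- The Kepler ellipse: parameter `c = e`, so semi-major axis `a`, eccentricity `e`,
foci `(0, 0)` and `(-2 a e, 0)`. -/
def keplerEllipse (a e : ℝ) : Set Plane := ellipse a e e

/-- The parameter `e~ = (3 e - 2 √2) / (2 √2 e - 3)`. -/
def eTilde (e : ℝ) : ℝ := (-(2 * √2) + 3 * e) / (-3 + 2 * √2 * e)

/-- The denominator `(e r - x) ^ 2 + (1 - e ^ 2) y ^ 2`, with `r = √(x ^ 2 + y ^ 2)`. -/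
def driftDenom (e x y : ℝ) : ℝ :=
  (e * √(x ^ 2 + y ^ 2) - x) ^ 2 + (1 - e ^ 2) * y ^ 2

/-- The function `α` in the drift. -/
def driftAlpha (μ lam e x y : ℝ) : ℝ :=
  √(1 / 2 * √(((e * √(x ^ 2 + y ^ 2) - x - 4 * lam ^ 2 * e / μ) ^ 2 + (1 - e ^ 2) * y ^ 2)
        / driftDenom e x y)
    + 1 / 2 * (((e * √(x ^ 2 + y ^ 2) - x - 2 * lam ^ 2 * e / μ) ^ 2 + (1 - e ^ 2) * y ^ 2
        - 4 * lam ^ 4 * e ^ 2 / μ ^ 2) / driftDenom e x y))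

/-- The function `β` in the drift. -/
def driftBeta (μ lam e x y : ℝ) : ℝ :=
  -(2 * lam ^ 2 * e * √(1 - e ^ 2) * y) /
    (μ * driftDenom e x y * driftAlpha μ lam e x y)

/-- The drift `b = (b_x, b_y)`. Its formulas are meaningful off the segment from
`(-4 a e / (1 + e), 0)` to `(0, 0)`, which lies inside every ellipse of parameter `c < 1`. -/
def drift (μ lam e : ℝ) (p : Plane) : Plane :=
  !₂[μ / (2 * lam) *
      ((driftAlpha μ lam e (p 0) (p 1) + driftBeta μ lam e (p 0) (p 1) - 1) * (1 / e)
        - (driftAlpha μ lam e (p 0) (p 1) + driftBeta μ lam e (p 0) (p 1) + 1)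
          * (p 0 / √(p 0 ^ 2 + p 1 ^ 2))),
    μ / (2 * lam) *
      ((driftAlpha μ lam e (p 0) (p 1) - driftBeta μ lam e (p 0) (p 1) - 1)
          * (√(1 - e ^ 2) / e)
        - (driftAlpha μ lam e (p 0) (p 1) + driftBeta μ lam e (p 0) (p 1) + 1)
          * (p 1 / √(p 0 ^ 2 + p 1 ^ 2)))]

/-- `x` solves the Keplerian dynamical system `x' = b(x)` on the time set `J`
(with one-sided derivatives at end points of `J` that belong to `J`). -/
def IsOrbitOn (μ lam e : ℝ) (J : Set ℝ) (x : ℝ → Plane) : Prop :=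
  IsIntegralCurveOn x (fun _ => drift μ lam e) J

/-- `y` is a Keplerian motion on the Kepler ellipse with force constant `μ`, semi-major axis `a`
and eccentricity `e`, run anticlockwise: Newton's equation with an inverse-square force holds,
with energy `-μ / (2 a)`, and so do the three laws of Kepler. -/
structure IsKeplerianMotion (μ a e : ℝ) (y : ℝ → Plane) : Prop where
  differentiable : Differentiable ℝ y
  /-- Newton's equation `y'' = -μ y / |y| ^ 3`. -/
  newton : ∀ t, HasDerivAt (deriv y) (-(μ / ‖y t‖ ^ 3) • y t) t
  energy : ∀ t, ‖deriv y t‖ ^ 2 / 2 - μ / ‖y t‖ = -(μ / (2 * a))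
  /-- First law: the motion traverses the ellipse, a focus of which is at the origin. -/
  range_eq : range y = keplerEllipse a e
  /-- Second law: twice the areal velocity is constant, namely `√(μ a (1 - e ^ 2))`. -/
  areas : ∀ t, y t 0 * deriv y t 1 - y t 1 * deriv y t 0 = √(μ * a * (1 - e ^ 2))
  /-- Third law: the exact period is `2 π √(a ^ 3 / μ)`. -/
  period : ∀ s t, y s = y t ↔ ∃ k : ℤ, s = t + k * (2 * Real.pi * √(a ^ 3 / μ))

/-- The orbit `x` settles down, as time tends to infinity, to Keplerian motion on the Kepler
ellipse: some orbit `y` of the system is a Keplerian motion on that ellipse, and the positions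
and velocities of `x` and `y` approach each other. -/
def SettlesToKeplerian (μ lam e : ℝ) (x : ℝ → Plane) : Prop :=
  ∃ y : ℝ → Plane, IsOrbitOn μ lam e univ y ∧ IsKeplerianMotion μ (semiMajor μ lam) e y ∧
    Tendsto (fun t => dist (x t) (y t)) atTop (𝓝 0) ∧
    Tendsto (fun t => dist (deriv x t) (deriv y t)) atTop (𝓝 0)

end KeplerFlow

end

/-! Put `z = ρ exp (i v)`. The relation `2 a e - (e r - x) + i √(1 - e²) y = a (z + e² / z)`
parametrizes the plane by `ρ ≥ e` and an angle `v`, and the circle `ρ = e` collapses onto the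
singular segment. In these coordinates every root in the drift disappears, because `α + i β = (z +
e) / (z - e)`. The circle `ρ = 1` is the Kepler ellipse and `ρ = √2 e` is the ellipse of parameter
`eTilde e`.

The system becomes `ρ' = -(ρ - 1) G(ρ, v)`, `v' = H(ρ, v)` (`drift_ellipticPoint`). The sign of `G`
is that of `ρ - e (sin v - cos v)`, so `G > 0` once `ρ > √2 e`; this is where the excluded ellipse
comes from. Hence `ρ` moves monotonically towards 1 between `ρ₀` and 1. Compactness in `ρ` and
periodicity in `v` bound `G` below by some `δ > 0`, so the decay is exponential
(`exists_elliptic_orbit`).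

On `ρ = 1` the mean anomaly `M = v - e sin v` grows at the constant rate `n = μ² / lam³`, which is
Kepler's equation. Off that circle `M' - n` is `ρ - 1` times a bounded function, hence integrable,
and `M - n t` tends to some `τ` (`exists_tendsto_phase`). The Keplerian motion with mean anomaly `n
t + τ` is the limit motion: positions converge by uniform continuity, and velocities too because
they are values of the continuous drift (`exists_settling_orbit`). Uniqueness holds because the
drift is `C¹` off the segment. -/

noncomputable section

namespace KeplerFlow

/-! ### Uniqueness and global existence for autonomous equations. -/

section ODE

variable {E : Type*} [NormedAddCommGroup E] [NormedSpace ℝ E]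

/-- Two solutions of an autonomous equation that start at the same point agree as long as the
field is locally Lipschitz along the first one. -/
theorem eqOn_Ico_of_lipschitz_along {f : E → E} {x y : ℝ → E} {a b : ℝ}
    (hx : IsIntegralCurveOn x (fun _ => f) (Ico a b))
    (hy : IsIntegralCurveOn y (fun _ => f) (Ico a b)) (hxy : y a = x a)
    (hf : ∀ t ∈ Ico a b, ∃ K, ∃ s ∈ 𝓝 (x t), LipschitzOnWith K f s) :
    EqOn y x (Ico a b) := by
  intro t ht
  have hsub : Icc a t ⊆ Ico a b := fun u hu => ⟨hu.1, hu.2.trans_lt ht.2⟩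
  have hder : ∀ {z : ℝ → E}, IsIntegralCurveOn z (fun _ => f) (Ico a b) → ∀ u ∈ Ico a b,
      HasDerivWithinAt z (f (z u)) (Ici u) u := by
    intro z hz u hu
    have h := (hz u hu).mono (Ico_subset_Ico_left hu.1)
    exact h.mono_of_mem_nhdsWithin (Ico_mem_nhdsGE hu.2)
  have hclosed : IsClosed ({u | y u = x u} ∩ Icc a t) := by
    rw [inter_comm]
    exact ((hy.continuousOn.mono hsub).prodMk (hx.continuousOn.mono hsub)).preimage_isClosed_of_isClosed
      isClosed_Icc isClosed_diagonal
  -- Continuous induction: the agreement set is closed, and at each of its points `y u = x u` puts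
  -- both curves in the same Lipschitz neighbourhood, so agreement extends to the right.
  refine hclosed.Icc_subset_of_forall_mem_nhdsWithin hxy ?_ ⟨ht.1, le_rfl⟩
  rintro u ⟨hu, hua, hut⟩
  have hub : u ∈ Ico a b := ⟨hua, hut.trans ht.2⟩
  obtain ⟨K, s, hs, hK⟩ := hf u hub
  have hys : ∀ᶠ w in 𝓝[≥] u, y w ∈ s :=
    (hder hy u hub).continuousWithinAt (by rw [show y u = x u from hu]; exact hs)
  have hxs : ∀ᶠ w in 𝓝[≥] u, x w ∈ s := (hder hx u hub).continuousWithinAt hs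
  have hall : ∀ᶠ w in 𝓝[≥] u, w ∈ Ico u b ∧ x w ∈ s ∧ y w ∈ s :=
    Filter.Eventually.and (Ico_mem_nhdsGE hub.2) (hxs.and hys)
  obtain ⟨d, hd, hsubd⟩ := (mem_nhdsGE_iff_exists_Icc_subset).1 hall
  have hmem : ∀ w ∈ Icc u d, w ∈ Ico a b := fun w hw =>
    ⟨hua.trans hw.1, (hsubd hw).1.2⟩
  have heq : EqOn y x (Icc u d) :=
    ODE_solution_unique_of_mem_Icc_right (v := fun _ => f) (s := fun _ => s) (K := K)
      (fun _ _ => hK)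
      (hy.continuousOn.mono hmem) (fun w hw => hder hy w (hmem w ⟨hw.1, hw.2.le⟩))
      (fun w hw => (hsubd ⟨hw.1, hw.2.le⟩).2.2)
      (hx.continuousOn.mono hmem) (fun w hw => hder hx w (hmem w ⟨hw.1, hw.2.le⟩))
      (fun w hw => (hsubd ⟨hw.1, hw.2.le⟩).2.1) hu
  exact mem_of_superset (Ioc_mem_nhdsGT hd) fun w hw => heq ⟨hw.1.le, hw.2⟩

/-- A bounded locally Lipschitz field has forward solutions for all times. -/
theorem exists_isIntegralCurveOn_Ici [ProperSpace E] {f : E → E}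
    (hf : LocallyLipschitz f) {L : ℝ} (hL : ∀ p, ‖f p‖ ≤ L) (t₀ : ℝ) (p₀ : E) :
    ∃ γ : ℝ → E, γ t₀ = p₀ ∧ IsIntegralCurveOn γ (fun _ => f) (Ici t₀) := by
  have hL0 : 0 ≤ L := (norm_nonneg _).trans (hL p₀)
  have hsol : ∀ n : ℕ, ∃ γ : ℝ → E, γ t₀ = p₀ ∧
      IsIntegralCurveOn γ (fun _ => f) (Ico t₀ (t₀ + n)) := by
    intro n
    -- In time `n` a curve of speed at most `L` stays in the ball of radius `L n`; there compactness
    -- turns the local Lipschitz property into a uniform one.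
    let A : NNReal := ⟨L * n, by positivity⟩
    obtain ⟨K, hK⟩ := (hf.locallyLipschitzOn (s := Metric.closedBall
      p₀ A)).exists_lipschitzOnWith_of_compact (isCompact_closedBall p₀ (A : ℝ))
    have ht : t₀ ∈ Icc t₀ (t₀ + n) := ⟨le_rfl, by simp⟩
    have hP : IsPicardLindelof (fun _ => f) (⟨t₀, ht⟩ : Icc t₀ (t₀ + n)) p₀ A 0 ⟨L, hL0⟩ K :=
      { lipschitzOnWith := fun _ _ => hK
        continuousOn := fun _ _ => continuousOn_const
        norm_le := fun _ _ p _ => hL p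
        mul_max_le := by simp [A]; exact le_rfl }
    obtain ⟨γ, h0, hγ⟩ := hP.exists_eq_forall_mem_Icc_hasDerivWithinAt₀
    exact ⟨γ, h0, fun t ht => (hγ t (Ico_subset_Icc_self ht)).mono Ico_subset_Icc_self⟩
  choose γ h0 hγ using hsol
  have hagree : ∀ {m n : ℕ}, m ≤ n → EqOn (γ n) (γ m) (Ico t₀ (t₀ + m)) := by
    intro m n hmn
    refine eqOn_Ico_of_lipschitz_along (hγ m) ((hγ n).mono (Ico_subset_Ico_right ?_))
      ((h0 n).trans (h0 m).symm) fun t _ => hf (γ m t)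
    gcongr
  have hagree' : ∀ {t : ℝ} {m n : ℕ}, t ∈ Ico t₀ (t₀ + m) → t ∈ Ico t₀ (t₀ + n) →
      γ n t = γ m t := by
    intro t m n hm hn
    rcases le_total m n with h | h
    · exact hagree h hm
    · exact (hagree h hn).symm
  have hidx : ∀ {t : ℝ}, t₀ ≤ t → t ∈ Ico t₀ (t₀ + ((⌊t - t₀⌋₊ + 1 : ℕ) : ℝ)) := by
    intro t ht
    refine ⟨ht, ?_⟩
    have := Nat.lt_floor_add_one (t - t₀)
    push_cast
    linarith
  -- The `+ 1` puts `t` strictly inside the half-open interval on which the chosen local solution is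
  -- defined.
  refine ⟨fun t => γ (⌊t - t₀⌋₊ + 1) t, by simp [h0], fun t ht => ?_⟩
  obtain ⟨n, hn⟩ := exists_nat_gt (t - t₀)
  have htn : t ∈ Ico t₀ (t₀ + n) := ⟨ht, by linarith⟩
  have hval : γ (⌊t - t₀⌋₊ + 1) t = γ n t := hagree' htn (hidx ht)
  simp only [hval]
  have hnhds : Ico t₀ (t₀ + n) ∈ 𝓝[Ici t₀] t :=
    mem_nhdsWithin.2 ⟨Iio (t₀ + n), isOpen_Iio, htn.2, fun w hw => ⟨hw.2, hw.1⟩⟩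
  refine ((hγ n t htn).congr_of_eventuallyEq_of_mem ?_ htn).mono_of_mem_nhdsWithin hnhds
  filter_upwards [self_mem_nhdsWithin] with w hw
  exact hagree' hw (hidx hw.1)

end ODE

/-- A `C¹` field precomposed with a locally Lipschitz map is locally Lipschitz. -/
theorem locallyLipschitz_comp_of_contDiffAt {X F G : Type*} [PseudoEMetricSpace X] [NormedAddCommGroup F]
    [NormedSpace ℝ F] [NormedAddCommGroup G] [NormedSpace ℝ G] {g : X → F} {f : F → G}
    (hg : LocallyLipschitz g) (hf : ∀ p, ContDiffAt ℝ 1 f (g p)) :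
    LocallyLipschitz (f ∘ g) := by
  intro p
  obtain ⟨K, t, ht, hK⟩ := (hf p).exists_lipschitzOnWith
  obtain ⟨K', s, hs, hK'⟩ := hg p
  exact ⟨K * K', s ∩ g ⁻¹' t, inter_mem hs (hg.continuous.continuousAt ht),
    hK.comp (hK'.mono inter_subset_left) fun w hw => hw.2⟩

/-! ### Elliptic coordinates and the ingredients of the drift. -/

/-- The point with elliptic coordinates `(ρ, v)`: the circle `ρ = 1` is the Kepler ellipse, on
which `v` is the eccentric anomaly. -/
def ellipticPoint (a e ρ v : ℝ) : Plane :=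
  !₂[a * (e * (ρ + e ^ 2 / ρ - 2) + (ρ + e ^ 2 / ρ - 2 * e ^ 2) * Real.cos v) / (1 - e ^ 2),
    a * (ρ - e ^ 2 / ρ) * Real.sin v / √(1 - e ^ 2)]

/-- `ρ (1 - e ^ 2) / a` times the distance of the point with coordinates `(ρ, v)` to the
origin. -/
def radiusNum (e ρ v : ℝ) : ℝ :=
  ρ ^ 2 + e ^ 2 - 2 * e ^ 2 * ρ + e * Real.cos v * (ρ ^ 2 + e ^ 2 - 2 * ρ)

/-- The square of the modulus of `ρ exp (i v) + e`. -/
def sqNormAdd (e ρ v : ℝ) : ℝ := ρ ^ 2 + 2 * e * ρ * Real.cos v + e ^ 2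

/-- The square of the modulus of `ρ exp (i v) - e`. -/
def sqNormSub (e ρ v : ℝ) : ℝ := ρ ^ 2 - 2 * e * ρ * Real.cos v + e ^ 2

/-- The rate of decay of `ρ - 1` along the flow. -/
def radialRate (μ lam e ρ v : ℝ) : ℝ :=
  μ ^ 2 / lam ^ 3 * (1 - e ^ 2) * ρ ^ 2 * (ρ + e * Real.cos v - e * Real.sin v) /
    (radiusNum e ρ v * sqNormAdd e ρ v)

/-- The angular velocity `dv / dt` of the flow. -/
def angularRate (μ lam e ρ v : ℝ) : ℝ :=
  μ ^ 2 / lam ^ 3 * (1 - e ^ 2) * ρ *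
      (ρ + e ^ 2 + e * Real.cos v * (ρ + 1) - e * Real.sin v * (ρ - 1)) /
    (radiusNum e ρ v * sqNormAdd e ρ v)

theorem ellipticPoint_zero (a e ρ v : ℝ) : ellipticPoint a e ρ v 0 =
    a * (e * (ρ + e ^ 2 / ρ - 2) + (ρ + e ^ 2 / ρ - 2 * e ^ 2) * Real.cos v) / (1 - e ^ 2) := rfl

theorem ellipticPoint_one (a e ρ v : ℝ) : ellipticPoint a e ρ v 1 =
    a * (ρ - e ^ 2 / ρ) * Real.sin v / √(1 - e ^ 2) := rfl

section

variable {a e ρ v : ℝ}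

/-- The expression is affine in `cos v`, hence a convex combination of its values at `cos v = 1` and
`cos v = -1`, both positive multiples of squares. -/
theorem radiusNum_pos (he : 0 < e) (he1 : e < 1) (hρ : e < ρ) : 0 < radiusNum e ρ v := by
  have h1 : 0 ≤ 1 + Real.cos v := by linarith [Real.neg_one_le_cos v]
  have h2 : 0 ≤ 1 - Real.cos v := by linarith [Real.cos_le_one v]
  have h3 : 0 < (1 + e) * (ρ - e) ^ 2 := by have := sub_pos.2 hρ; positivity
  have h4 : 0 < (1 - e) * (ρ + e) ^ 2 := by
    have := sub_pos.2 he1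
    have := he.trans hρ
    positivity
  have key : 2 * radiusNum e ρ v = (1 + Real.cos v) * ((1 + e) * (ρ - e) ^ 2) +
      (1 - Real.cos v) * ((1 - e) * (ρ + e) ^ 2) := by unfold radiusNum; ring
  rcases h1.eq_or_lt with h | h
  · have : 0 < 1 - Real.cos v := by linarith
    nlinarith [mul_pos this h4]
  · nlinarith [mul_pos h h3, mul_nonneg h2 h4.le]

theorem radiusNum_nonneg (he : 0 < e) (he1 : e < 1) : 0 ≤ radiusNum e ρ v := by
  have h1 : 0 ≤ 1 + Real.cos v := by linarith [Real.neg_one_le_cos v]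
  have h2 : 0 ≤ 1 - Real.cos v := by linarith [Real.cos_le_one v]
  have h3 : 0 ≤ 1 - e := by linarith
  have key : 2 * radiusNum e ρ v = (1 + Real.cos v) * ((1 + e) * (ρ - e) ^ 2) +
      (1 - Real.cos v) * ((1 - e) * (ρ + e) ^ 2) := by unfold radiusNum; ring
  have : 0 ≤ (1 + Real.cos v) * ((1 + e) * (ρ - e) ^ 2) := by positivity
  have : 0 ≤ (1 - Real.cos v) * ((1 - e) * (ρ + e) ^ 2) := by positivity
  linarith

theorem sqNormSub_pos (he : 0 < e) (hρ : e < ρ) : 0 < sqNormSub e ρ v := by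
  have h2 : 0 ≤ 1 - Real.cos v := by linarith [Real.cos_le_one v]
  have h3 : 0 < (ρ - e) ^ 2 := by have := sub_pos.2 hρ; positivity
  have : 0 ≤ e * ρ * (1 - Real.cos v) := by have := he.trans hρ; positivity
  unfold sqNormSub
  linarith

theorem sqNormAdd_pos (he : 0 < e) (hρ : e < ρ) : 0 < sqNormAdd e ρ v := by
  have h2 : 0 ≤ 1 + Real.cos v := by linarith [Real.neg_one_le_cos v]
  have h3 : 0 < (ρ - e) ^ 2 := by have := sub_pos.2 hρ; positivity
  have : 0 ≤ e * ρ * (1 + Real.cos v) := by have := he.trans hρ; positivity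
  unfold sqNormAdd
  linarith

theorem one_sub_sq_pos (he : 0 < e) (he1 : e < 1) : 0 < 1 - e ^ 2 := by nlinarith

theorem ellipticPoint_sq_add_sq (he : 0 < e) (he1 : e < 1) (hρ : e ≤ ρ) :
    ellipticPoint a e ρ v 0 ^ 2 + ellipticPoint a e ρ v 1 ^ 2 =
      (a * radiusNum e ρ v / (ρ * (1 - e ^ 2))) ^ 2 := by
  have hs := one_sub_sq_pos he he1
  have hρ0 : ρ ≠ 0 := (he.trans_le hρ).ne'
  have h1 : √(1 - e ^ 2) ^ 2 = 1 - e ^ 2 := Real.sq_sqrt hs.le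
  rw [ellipticPoint_zero, ellipticPoint_one, div_pow _ (√_), h1, mul_pow _ (Real.sin v),
    Real.sin_sq, radiusNum]
  field_simp
  ring

theorem sqrt_ellipticPoint (ha : 0 < a) (he : 0 < e) (he1 : e < 1) (hρ : e ≤ ρ) :
    √(ellipticPoint a e ρ v 0 ^ 2 + ellipticPoint a e ρ v 1 ^ 2) =
      a * radiusNum e ρ v / (ρ * (1 - e ^ 2)) := by
  have hs := one_sub_sq_pos he he1
  have hρ0 : 0 < ρ := he.trans_le hρ
  have hN := radiusNum_nonneg (ρ := ρ) (v := v) he he1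
  rw [ellipticPoint_sq_add_sq he he1 hρ, Real.sqrt_sq (by positivity)]

/-- The real part of the complex relation that defines the coordinates: `(ρ + e² / ρ) cos v` is the
real part of `z + e² / z`. -/
theorem mul_radius_sub (he : 0 < e) (he1 : e < 1) (hρ : e < ρ) :
    e * (a * radiusNum e ρ v / (ρ * (1 - e ^ 2))) - ellipticPoint a e ρ v 0 =
      2 * a * e - a * (ρ + e ^ 2 / ρ) * Real.cos v := by
  have hs := one_sub_sq_pos he he1
  have hρ0 : ρ ≠ 0 := (he.trans hρ).ne'
  rw [ellipticPoint_zero, radiusNum]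
  field_simp
  ring

theorem one_sub_sq_mul_sq (he : 0 < e) (he1 : e < 1) :
    (1 - e ^ 2) * ellipticPoint a e ρ v 1 ^ 2 =
      a ^ 2 * (ρ - e ^ 2 / ρ) ^ 2 * (1 - Real.cos v ^ 2) := by
  have hs := one_sub_sq_pos he he1
  have h1 : √(1 - e ^ 2) ^ 2 = 1 - e ^ 2 := Real.sq_sqrt hs.le
  rw [ellipticPoint_one, div_pow, h1, mul_pow _ (Real.sin v), Real.sin_sq]
  field_simp

/-- A perfect square, since `z + e² / z - 2 e = (z - e)² / z`. The numerator below is the same with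
`z + e`. -/
theorem driftDenom_ellipticPoint (ha : 0 < a) (he : 0 < e) (he1 : e < 1) (hρ : e < ρ) :
    driftDenom e (ellipticPoint a e ρ v 0) (ellipticPoint a e ρ v 1) =
      (a * sqNormSub e ρ v / ρ) ^ 2 := by
  have hρ0 : ρ ≠ 0 := (he.trans hρ).ne'
  rw [driftDenom, sqrt_ellipticPoint ha he he1 hρ.le, mul_radius_sub he he1 hρ,
    one_sub_sq_mul_sq he he1, sqNormSub]
  field_simp
  ring

theorem driftNum_ellipticPoint (ha : 0 < a) (he : 0 < e) (he1 : e < 1) (hρ : e < ρ) :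
    (e * √(ellipticPoint a e ρ v 0 ^ 2 + ellipticPoint a e ρ v 1 ^ 2) - ellipticPoint a e ρ v 0
        - 4 * a * e) ^ 2 + (1 - e ^ 2) * ellipticPoint a e ρ v 1 ^ 2 =
      (a * sqNormAdd e ρ v / ρ) ^ 2 := by
  have hρ0 : ρ ≠ 0 := (he.trans hρ).ne'
  rw [sqrt_ellipticPoint ha he he1 hρ.le, mul_radius_sub he he1 hρ,
    one_sub_sq_mul_sq he he1, sqNormAdd]
  field_simp
  ring

theorem driftNum'_ellipticPoint (ha : 0 < a) (he : 0 < e) (he1 : e < 1) (hρ : e < ρ) :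
    (e * √(ellipticPoint a e ρ v 0 ^ 2 + ellipticPoint a e ρ v 1 ^ 2) - ellipticPoint a e ρ v 0
        - 2 * a * e) ^ 2 + (1 - e ^ 2) * ellipticPoint a e ρ v 1 ^ 2 - 4 * a ^ 2 * e ^ 2 =
      (a / ρ) ^ 2 * ((ρ ^ 2 - e ^ 2) ^ 2 - (2 * e * ρ * Real.sin v) ^ 2) := by
  have hρ0 : ρ ≠ 0 := (he.trans hρ).ne'
  rw [sqrt_ellipticPoint ha he he1 hρ.le, mul_radius_sub he he1 hρ,
    one_sub_sq_mul_sq he he1, mul_pow _ (Real.sin v), Real.sin_sq]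
  field_simp
  ring

end

/-! ### The drift in elliptic coordinates. -/

section

variable {μ lam e ρ v : ℝ}

theorem semiMajor_pos (hμ : 0 < μ) (hlam : 0 < lam) : 0 < semiMajor μ lam := by
  unfold semiMajor; positivity

/-- The argument of the outer square root in the definition of `α`. -/
theorem driftAlpha_arg (hμ : 0 < μ) (hlam : 0 < lam) (he : 0 < e) (he1 : e < 1) (hρ : e < ρ)
    {x y : ℝ} (hx : x = ellipticPoint (semiMajor μ lam) e ρ v 0)
    (hy : y = ellipticPoint (semiMajor μ lam) e ρ v 1) :
    1 / 2 * √(((e * √(x ^ 2 + y ^ 2) - x - 4 * lam ^ 2 * e / μ) ^ 2 + (1 - e ^ 2) * y ^ 2)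
        / driftDenom e x y)
    + 1 / 2 * (((e * √(x ^ 2 + y ^ 2) - x - 2 * lam ^ 2 * e / μ) ^ 2 + (1 - e ^ 2) * y ^ 2
        - 4 * lam ^ 4 * e ^ 2 / μ ^ 2) / driftDenom e x y) =
      ((ρ ^ 2 - e ^ 2) / sqNormSub e ρ v) ^ 2 := by
  have ha := semiMajor_pos hμ hlam
  have hρ0 : 0 < ρ := he.trans hρ
  have hp := sqNormSub_pos (v := v) he hρ
  have hq := sqNormAdd_pos (v := v) he hρ
  have e1 : 4 * lam ^ 2 * e / μ = 4 * semiMajor μ lam * e := by unfold semiMajor; ring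
  have e2 : 2 * lam ^ 2 * e / μ = 2 * semiMajor μ lam * e := by unfold semiMajor; ring
  have e3 : 4 * lam ^ 4 * e ^ 2 / μ ^ 2 = 4 * semiMajor μ lam ^ 2 * e ^ 2 := by
    unfold semiMajor; ring
  rw [e1, e2, e3, hx, hy, driftNum_ellipticPoint ha he he1 hρ, driftNum'_ellipticPoint ha he he1 hρ,
    driftDenom_ellipticPoint ha he he1 hρ, ← div_pow, Real.sqrt_sq (by positivity)]
  generalize semiMajor μ lam = a at *
  rw [mul_pow _ (Real.sin v), Real.sin_sq]
  have hp' : sqNormSub e ρ v ≠ 0 := hp.ne'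
  field_simp
  unfold sqNormAdd sqNormSub
  ring

/-- With `w = (z + e) / (z - e)`, the radicand of `α` is `(|w²| + Re w²) / 2 = (Re w)²`, and `Re w >
0` because `ρ > e`. In the same way `β` is `Im w`. -/
theorem driftAlpha_ellipticPoint (hμ : 0 < μ) (hlam : 0 < lam) (he : 0 < e) (he1 : e < 1)
    (hρ : e < ρ) :
    driftAlpha μ lam e (ellipticPoint (semiMajor μ lam) e ρ v 0)
        (ellipticPoint (semiMajor μ lam) e ρ v 1) = (ρ ^ 2 - e ^ 2) / sqNormSub e ρ v := by
  have hp := sqNormSub_pos (v := v) he hρ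
  have h : 0 ≤ ρ ^ 2 - e ^ 2 := by nlinarith
  rw [driftAlpha, driftAlpha_arg hμ hlam he he1 hρ rfl rfl, Real.sqrt_sq (by positivity)]

theorem driftBeta_ellipticPoint (hμ : 0 < μ) (hlam : 0 < lam) (he : 0 < e) (he1 : e < 1)
    (hρ : e < ρ) :
    driftBeta μ lam e (ellipticPoint (semiMajor μ lam) e ρ v 0)
        (ellipticPoint (semiMajor μ lam) e ρ v 1) =
      -(2 * e * ρ * Real.sin v) / sqNormSub e ρ v := by
  have hp := sqNormSub_pos (v := v) he hρ
  have hρ0 : 0 < ρ := he.trans hρ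
  have h : ρ ^ 2 - e ^ 2 ≠ 0 := by nlinarith
  have hs := one_sub_sq_pos he he1
  have hs' : √(1 - e ^ 2) ≠ 0 := (Real.sqrt_pos.2 hs).ne'
  rw [driftBeta, driftAlpha_ellipticPoint hμ hlam he he1 hρ,
    driftDenom_ellipticPoint (semiMajor_pos hμ hlam) he he1 hρ, ellipticPoint_one]
  unfold semiMajor
  field_simp

/-- The drift in elliptic coordinates. -/
theorem drift_ellipticPoint (hμ : 0 < μ) (hlam : 0 < lam) (he : 0 < e) (he1 : e < 1)
    (hρ : e < ρ) :
    drift μ lam e (ellipticPoint (semiMajor μ lam) e ρ v) =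
      !₂[semiMajor μ lam * (1 - e ^ 2 / ρ ^ 2) * (e + Real.cos v) / (1 - e ^ 2) *
            (-(ρ - 1) * radialRate μ lam e ρ v)
          - semiMajor μ lam * (ρ + e ^ 2 / ρ - 2 * e ^ 2) * Real.sin v / (1 - e ^ 2) *
            angularRate μ lam e ρ v,
        semiMajor μ lam * (1 + e ^ 2 / ρ ^ 2) * Real.sin v / √(1 - e ^ 2) *
            (-(ρ - 1) * radialRate μ lam e ρ v)
          + semiMajor μ lam * (ρ - e ^ 2 / ρ) * Real.cos v / √(1 - e ^ 2) *
            angularRate μ lam e ρ v] := by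
  have hp := (sqNormSub_pos (v := v) he hρ).ne'
  have hq := (sqNormAdd_pos (v := v) he hρ).ne'
  have hN := (radiusNum_pos (v := v) he he1 hρ).ne'
  have hρ0 : 0 < ρ := he.trans hρ
  have hs := one_sub_sq_pos he he1
  have hs0 := Real.sqrt_pos.2 hs
  have h1 : √(1 - e ^ 2) ^ 2 = 1 - e ^ 2 := Real.sq_sqrt hs.le
  have hs2 : Real.sin v ^ 2 = 1 - Real.cos v ^ 2 := Real.sin_sq v
  rw [drift, driftAlpha_ellipticPoint hμ hlam he he1 hρ, driftBeta_ellipticPoint hμ hlam he he1 hρ,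
    sqrt_ellipticPoint (semiMajor_pos hμ hlam) he he1 hρ.le, ellipticPoint_zero, ellipticPoint_one,
    radialRate, angularRate, semiMajor]
  -- The right-hand side is the chain rule for `ellipticPoint` with `ρ' = -(ρ - 1) radialRate` and
  -- `v' = angularRate`; what remains is a rational identity modulo `sin² + cos² = 1`.
  generalize √(1 - e ^ 2) = s at *
  congr 2
  · field_simp
    unfold radiusNum sqNormAdd sqNormSub
    ring_nf
    simp only [hs2]
    ring
  · congr 1
    field_simp
    rw [h1]
    unfold radiusNum sqNormAdd sqNormSub
    ring_nf
    simp only [hs2]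
    ring

end

/-! ### Ellipses in elliptic coordinates, and surjectivity of the coordinates. -/

theorem dist_plane (p q : Plane) : dist p q = √((p 0 - q 0) ^ 2 + (p 1 - q 1) ^ 2) := by
  rw [EuclideanSpace.dist_eq, Fin.sum_univ_two, Real.dist_eq, Real.dist_eq, sq_abs, sq_abs]

theorem dist_zero_plane (p : Plane) : dist p 0 = √(p 0 ^ 2 + p 1 ^ 2) := by
  rw [dist_plane]
  simp

/-- The two-focus and the focus-directrix descriptions of an ellipse. -/
theorem exists_pos_mul_focal_sum {a e c : ℝ} (ha : 0 < a) (he : 0 < e) (hc0 : 0 < c) (hc1 : c < 1)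
    (p : Plane) : ∃ m, 0 < m ∧
      m * (dist p 0 + dist p (ellipseFocus a e c) - 2 * ellipseAxis a e c) =
        dist p 0 + c * p 0 - ellipseAxis a e c * (1 - c ^ 2) := by
  have hA : 0 < ellipseAxis a e c := by unfold ellipseAxis; positivity
  have hF : ellipseFocus a e c = !₂[-(2 * ellipseAxis a e c * c), 0] := by
    unfold ellipseFocus ellipseAxis
    congr 2
    ring
  rw [hF]
  generalize ellipseAxis a e c = A at *
  have htri := dist_triangle p !₂[-(2 * A * c), 0] 0
  have h3 : dist (!₂[-(2 * A * c), 0] : Plane) 0 = 2 * A * c := by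
    rw [dist_zero_plane]
    simp [Real.sqrt_sq_eq_abs, abs_of_pos hA, abs_of_pos hc0]
  have h1 : dist p 0 ^ 2 = p 0 ^ 2 + p 1 ^ 2 := by
    rw [dist_zero_plane, Real.sq_sqrt (by positivity)]
  have h2 : dist p !₂[-(2 * A * c), 0] ^ 2 = (p 0 + 2 * A * c) ^ 2 + p 1 ^ 2 := by
    rw [dist_plane, Real.sq_sqrt (by positivity)]
    simp
  rw [h3] at htri
  generalize dist p 0 = r at *
  generalize dist p !₂[-(2 * A * c), 0] = d at *
  have hAc : A * c < A := by nlinarith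
  -- The product `(d + r - 2A)(d - r + 2A) = d² - (2A - r)²` is linear in `r` and `x`, as `d² - r²`
  -- is linear in `x`. The second factor is positive by the triangle inequality and `c < 1`.
  refine ⟨(d + 2 * A - r) / (4 * A), by apply div_pos <;> linarith, ?_⟩
  field_simp
  linear_combination h2 - h1

section

variable {a e ρ v : ℝ}

theorem sqrt_two_bounds : 1.4 < √2 ∧ √2 < 1.5 :=
  ⟨Real.lt_sqrt_of_sq_lt (by norm_num), (Real.sqrt_lt' (by norm_num)).2 (by norm_num)⟩

theorem sqrt_two_mul_lt_one (he' : e < 1 / √2) : √2 * e < 1 := by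
  rw [lt_div_iff₀ (by positivity)] at he'
  linarith

theorem lt_one_of_lt (he' : e < 1 / √2) (he : 0 < e) : e < 1 := by
  have := sqrt_two_mul_lt_one he'
  nlinarith [sqrt_two_bounds.1]

theorem eTilde_eq : eTilde e = (2 * √2 - 3 * e) / (3 - 2 * √2 * e) := by
  rw [eTilde, ← neg_div_neg_eq]
  congr 1 <;> ring

theorem eTilde_pos (he' : e < 1 / √2) : 0 < eTilde e := by
  have := sqrt_two_mul_lt_one he'
  have h2 : √2 ^ 2 = 2 := Real.sq_sqrt (by norm_num)
  have := sqrt_two_bounds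
  rw [eTilde_eq]
  apply div_pos <;> nlinarith

theorem eTilde_lt_one (he : 0 < e) (he' : e < 1 / √2) : eTilde e < 1 := by
  have := sqrt_two_mul_lt_one he'
  have := sqrt_two_bounds
  rw [eTilde_eq, div_lt_one (by linarith)]
  nlinarith

/-- The variables separate. The roots `√2 e` and `e / √2` are exchanged by `ρ ↦ e² / ρ`, and the
latter is below `e`, so for `ρ ≥ e` only `ρ = √2 e` gives a change of sign. -/
theorem ellipseExt_eTilde_expr (ha : 0 < a) (he : 0 < e) (he' : e < 1 / √2) (hρ : e ≤ ρ) :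
    dist (ellipticPoint a e ρ v) 0 + eTilde e * ellipticPoint a e ρ v 0 -
        ellipseAxis a e (eTilde e) * (1 - eTilde e ^ 2) =
      a / (1 - e ^ 2) * ((1 + e * eTilde e) + (e + eTilde e) * Real.cos v) *
        ((ρ - √2 * e) * (ρ - √2 / 2 * e) / ρ) := by
  have hρ0 := he.trans_le hρ
  have he1 := lt_one_of_lt he' he
  have hs := one_sub_sq_pos he he1
  have hlt := sqrt_two_mul_lt_one he'
  have h2 : √2 ^ 2 = 2 := Real.sq_sqrt (by norm_num)
  have hd : 0 < 3 - 2 * √2 * e := by linarith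
  have hec : e + eTilde e ≠ 0 := by have := eTilde_pos he'; positivity
  have hcc : eTilde e * (3 - 2 * √2 * e) = 2 * √2 - 3 * e := by
    rw [eTilde_eq]; field_simp
  have hA : ellipseAxis a e (eTilde e) * (1 - eTilde e ^ 2) * (1 - e ^ 2) =
      a * (e * (3 - 2 * √2 * e) * √2 / 2 * (1 - eTilde e ^ 2)) := by
    have hsum : (e + eTilde e) * (3 - 2 * √2 * e) = 2 * √2 * (1 - e ^ 2) := by
      linear_combination hcc
    have : ellipseAxis a e (eTilde e) * (1 - e ^ 2) = a * (e * (3 - 2 * √2 * e) * √2 / 2) := by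
      rw [ellipseAxis, div_mul_eq_mul_div, div_eq_iff hec]
      linear_combination -(a * e * √2 / 2) * hsum - a * e * (1 - e ^ 2) * h2
    linear_combination (1 - eTilde e ^ 2) * this
  rw [dist_zero_plane, sqrt_ellipticPoint ha he he1 hρ, ellipticPoint_zero, radiusNum,
    ← mul_left_inj' hs.ne', sub_mul _ _ (1 - e ^ 2), hA]
  generalize eTilde e = c at *
  generalize Real.cos v = w at *
  have key : ρ ^ 2 + e ^ 2 - 2 * e ^ 2 * ρ + e * w * (ρ ^ 2 + e ^ 2 - 2 * ρ) +
      c * (e * (ρ ^ 2 + e ^ 2 - 2 * ρ) + (ρ ^ 2 + e ^ 2 - 2 * e ^ 2 * ρ) * w) -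
      ρ * (e * (3 - 2 * √2 * e) * √2 / 2 * (1 - c ^ 2)) =
      ((1 + e * c) + (e + c) * w) * ((ρ - √2 * e) * (ρ - √2 / 2 * e)) := by
    linear_combination (ρ * e * √2 / 2 * (w + c)) * hcc +
      (ρ * w * e * (1 + e * c) + ρ * e * (e + c) - e ^ 2 * ((1 + e * c) + (e + c) * w) / 2) * h2
  field_simp
  linear_combination 2 * key

theorem ellipticPoint_mem_ellipseExt_iff (ha : 0 < a) (he : 0 < e) (he' : e < 1 / √2)
    (hρ : e ≤ ρ) :
    ellipticPoint a e ρ v ∈ ellipseExt a e (eTilde e) ↔ √2 * e < ρ := by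
  have hρ0 := he.trans_le hρ
  have he1 := lt_one_of_lt he' he
  have hs := one_sub_sq_pos he he1
  have hc0 := eTilde_pos he'
  have hc1 := eTilde_lt_one he he'
  obtain ⟨m, hm, h⟩ := exists_pos_mul_focal_sum ha he hc0 hc1 (ellipticPoint a e ρ v)
  rw [ellipseExt_eTilde_expr ha he he' hρ] at h
  have hpos : 0 < (1 + e * eTilde e) + (e + eTilde e) * Real.cos v := by
    nlinarith [mul_pos (sub_pos.2 he1) (sub_pos.2 hc1), Real.neg_one_le_cos v]
  have hpos' : 0 < ρ - √2 / 2 * e := by nlinarith [sqrt_two_bounds.2]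
  rw [ellipseExt, mem_ofPred_eq, ← sub_pos, ← mul_pos_iff_of_pos_left hm, h,
    mul_pos_iff_of_pos_left (by positivity), div_pos_iff_of_pos_right hρ0,
    mul_pos_iff_of_pos_right hpos', sub_pos]

/-- Elliptic coordinates cover the plane. -/
theorem exists_eq_ellipticPoint (ha : 0 < a) (he : 0 < e) (he1 : e < 1) (p : Plane) :
    ∃ ρ v, e ≤ ρ ∧ p = ellipticPoint a e ρ v := by
  have hs := one_sub_sq_pos he he1
  have hs0 := Real.sqrt_pos.2 hs
  have hs1 : √(1 - e ^ 2) ^ 2 = 1 - e ^ 2 := Real.sq_sqrt hs.le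
  set r := √(p 0 ^ 2 + p 1 ^ 2) with hr
  have hr2 : r ^ 2 = p 0 ^ 2 + p 1 ^ 2 := Real.sq_sqrt (by positivity)
  have hr0 : 0 ≤ r := Real.sqrt_nonneg _
  -- Solve `z + e² / z = b`. The two roots have product `e²`, so one of them has modulus at least
  -- `e`.
  let b : ℂ := ⟨2 * e - (e * r - p 0) / a, √(1 - e ^ 2) * p 1 / a⟩
  obtain ⟨z, hz, hez⟩ : ∃ z : ℂ, z * (b - z) = (e : ℂ) ^ 2 ∧ e ≤ ‖z‖ := by
    obtain ⟨u, hu⟩ := IsAlgClosed.exists_pow_nat_eq (b ^ 2 - 4 * (e : ℂ) ^ 2) (n := 2) two_pos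
    have h1 : (b + u) / 2 * (b - (b + u) / 2) = (e : ℂ) ^ 2 := by linear_combination -hu / 4
    by_cases h : e ≤ ‖(b + u) / 2‖
    · exact ⟨_, h1, h⟩
    · refine ⟨b - (b + u) / 2, by linear_combination h1, ?_⟩
      have h2 := congrArg norm h1
      rw [norm_mul, norm_pow, Complex.norm_real, Real.norm_eq_abs, sq_abs] at h2
      by_contra! h3
      push Not at h
      nlinarith [norm_nonneg ((b + u) / 2), norm_nonneg (b - (b + u) / 2)]
  have hρ0 : 0 < ‖z‖ := he.trans_le hez
  refine ⟨‖z‖, z.arg, hez, ?_⟩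
  have hre : z.re = ‖z‖ * Real.cos z.arg := (Complex.norm_mul_cos_arg z).symm
  have him : z.im = ‖z‖ * Real.sin z.arg := (Complex.norm_mul_sin_arg z).symm
  have hconj : (‖z‖ : ℂ) ^ 2 * (b - z) = (e : ℂ) ^ 2 * (starRingEnd ℂ) z := by
    rw [← hz, ← Complex.mul_conj']
    ring
  have hR := congrArg Complex.re hconj
  have hI := congrArg Complex.im hconj
  rw [← Complex.ofReal_pow, ← Complex.ofReal_pow, Complex.re_ofReal_mul, Complex.re_ofReal_mul,
    Complex.conj_re, Complex.sub_re, hre] at hR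
  rw [← Complex.ofReal_pow, ← Complex.ofReal_pow, Complex.im_ofReal_mul, Complex.im_ofReal_mul,
    Complex.conj_im, Complex.sub_im, him] at hI
  have hR' : e * r - p 0 = 2 * a * e - a * (‖z‖ + e ^ 2 / ‖z‖) * Real.cos z.arg := by
    simp only [b] at hR
    field_simp at hR ⊢
    linear_combination -hR
  have hI' : √(1 - e ^ 2) * p 1 = a * (‖z‖ - e ^ 2 / ‖z‖) * Real.sin z.arg := by
    simp only [b] at hI
    field_simp at hI ⊢
    linear_combination hI
  generalize ‖z‖ = ρ at *
  generalize z.arg = v at *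
  have hsc := Real.sin_sq v
  have hk : ρ + e ^ 2 / ρ - 2 * e * Real.cos v = sqNormSub e ρ v / ρ := by
    unfold sqNormSub; field_simp; ring
  have hp : 0 ≤ sqNormSub e ρ v := by
    have h2 : 0 ≤ 1 - Real.cos v := by linarith [Real.cos_le_one v]
    have : 0 ≤ e * ρ * (1 - Real.cos v) := by positivity
    unfold sqNormSub
    nlinarith [sq_nonneg (ρ - e)]
  have hrx : 0 ≤ r - e * p 0 := by
    have : p 0 ≤ r := Real.le_sqrt_of_sq_le (by nlinarith [sq_nonneg (p 1)])
    nlinarith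
  -- `e r - x` alone does not determine `x`; `r - e x` is needed as well. It follows from `(r - e
  -- x)² = (e r - x)² + (1 - e²) y²` and a comparison of signs.
  have hsq : (r - e * p 0) ^ 2 = (a * (ρ + e ^ 2 / ρ - 2 * e * Real.cos v)) ^ 2 := by
    have e1 : (r - e * p 0) ^ 2 = (e * r - p 0) ^ 2 + (√(1 - e ^ 2) * p 1) ^ 2 := by
      rw [mul_pow, hs1]
      linear_combination (1 - e ^ 2) * hr2
    rw [e1, hR', hI', mul_pow _ (Real.sin v), hsc]
    field_simp
    ring
  have hW : r - e * p 0 = a * (ρ + e ^ 2 / ρ - 2 * e * Real.cos v) := by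
    refine (sq_eq_sq₀ hrx ?_).1 hsq
    rw [hk]
    positivity
  ext i
  fin_cases i
  · change p 0 = _
    rw [Fin.zero_eta, ellipticPoint_zero, eq_div_iff hs.ne']
    linear_combination e * hW - hR'
  · change p 1 = _
    rw [Fin.mk_one, ellipticPoint_one, eq_div_iff hs0.ne']
    linear_combination hI'

end

/-! ### Smoothness of the drift and transfer of orbits to the plane. -/

section

variable {μ lam e ρ v : ℝ}

/-- The drift is continuously differentiable off the segment between the origin and
`(-4 a e / (1 + e), 0)`. -/
theorem contDiffAt_drift (hμ : 0 < μ) (hlam : 0 < lam) (he : 0 < e) (he1 : e < 1) (hρ : e < ρ) :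
    ContDiffAt ℝ 1 (drift μ lam e) (ellipticPoint (semiMajor μ lam) e ρ v) := by
  have ha := semiMajor_pos hμ hlam
  have hρ0 := he.trans hρ
  have hN := radiusNum_pos (v := v) he he1 hρ
  have hp := sqNormSub_pos (v := v) he hρ
  have hq := sqNormAdd_pos (v := v) he hρ
  have hs := one_sub_sq_pos he he1
  have hα := driftAlpha_arg hμ hlam he he1 hρ (v := v) rfl rfl
  have hα0 := driftAlpha_ellipticPoint hμ hlam he he1 hρ (v := v)
  have hD := driftDenom_ellipticPoint ha he he1 hρ (v := v)
  have hr := ellipticPoint_sq_add_sq he he1 hρ.le (a := semiMajor μ lam) (v := v)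
  have hr' := sqrt_ellipticPoint ha he he1 hρ.le (v := v)
  have hM := driftNum_ellipticPoint ha he he1 hρ (v := v)
  have e1 : 4 * lam ^ 2 * e / μ = 4 * semiMajor μ lam * e := by unfold semiMajor; ring
  rw [← e1] at hM
  generalize ellipticPoint (semiMajor μ lam) e ρ v = p at *
  have hρe : 0 < ρ ^ 2 - e ^ 2 := by nlinarith
  have hsq : p 0 ^ 2 + p 1 ^ 2 ≠ 0 := by rw [hr]; positivity
  have hr0 : √(p 0 ^ 2 + p 1 ^ 2) ≠ 0 := by rw [hr']; positivity
  have hD0 : driftDenom e (p 0) (p 1) ≠ 0 := by rw [hD]; positivity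
  have hM0 : ((e * √(p 0 ^ 2 + p 1 ^ 2) - p 0 - 4 * lam ^ 2 * e / μ) ^ 2 + (1 - e ^ 2) * p 1 ^ 2)
      / driftDenom e (p 0) (p 1) ≠ 0 := by
    refine div_ne_zero ?_ hD0
    rw [hM]; positivity
  have hα1 : driftAlpha μ lam e (p 0) (p 1) ≠ 0 := by rw [hα0]; positivity
  have hx : ContDiffAt ℝ 1 (fun p : Plane => p 0) p := by fun_prop
  have hy : ContDiffAt ℝ 1 (fun p : Plane => p 1) p := by fun_prop
  have hR : ContDiffAt ℝ 1 (fun p : Plane => √(p 0 ^ 2 + p 1 ^ 2)) p :=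
    ((hx.pow 2).add (hy.pow 2)).sqrt hsq
  have hDC : ContDiffAt ℝ 1 (fun p : Plane => driftDenom e (p 0) (p 1)) p := by
    unfold driftDenom
    fun_prop
  have hin : ContDiffAt ℝ 1 (fun p : Plane =>
      √(((e * √(p 0 ^ 2 + p 1 ^ 2) - p 0 - 4 * lam ^ 2 * e / μ) ^ 2 + (1 - e ^ 2) * p 1 ^ 2)
        / driftDenom e (p 0) (p 1))) p := by
    refine ContDiffAt.sqrt (ContDiffAt.div ?_ hDC hD0) hM0
    fun_prop
  have hA : ContDiffAt ℝ 1 (fun p : Plane => driftAlpha μ lam e (p 0) (p 1)) p := by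
    unfold driftAlpha
    refine ContDiffAt.sqrt ((contDiffAt_const.mul hin).add
      (contDiffAt_const.mul (ContDiffAt.div ?_ hDC hD0))) ?_
    · fun_prop
    · rw [hα]; positivity
  have hB : ContDiffAt ℝ 1 (fun p : Plane => driftBeta μ lam e (p 0) (p 1)) p := by
    unfold driftBeta
    refine ContDiffAt.div ?_ ((contDiffAt_const.mul hDC).mul hA)
      (mul_ne_zero (mul_ne_zero hμ.ne' hD0) hα1)
    fun_prop
  have hcx : ContDiffAt ℝ 1 (fun p : Plane => p 0 / √(p 0 ^ 2 + p 1 ^ 2)) p := hx.div hR hr0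
  have hcy : ContDiffAt ℝ 1 (fun p : Plane => p 1 / √(p 0 ^ 2 + p 1 ^ 2)) p := hy.div hR hr0
  rw [contDiffAt_piLp]
  intro i
  fin_cases i
  · change ContDiffAt ℝ 1 (fun p : Plane => μ / (2 * lam) *
      ((driftAlpha μ lam e (p 0) (p 1) + driftBeta μ lam e (p 0) (p 1) - 1) * (1 / e)
        - (driftAlpha μ lam e (p 0) (p 1) + driftBeta μ lam e (p 0) (p 1) + 1)
          * (p 0 / √(p 0 ^ 2 + p 1 ^ 2)))) p
    fun_prop
  · change ContDiffAt ℝ 1 (fun p : Plane => μ / (2 * lam) *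
      ((driftAlpha μ lam e (p 0) (p 1) - driftBeta μ lam e (p 0) (p 1) - 1) * (√(1 - e ^ 2) / e)
        - (driftAlpha μ lam e (p 0) (p 1) + driftBeta μ lam e (p 0) (p 1) + 1)
          * (p 1 / √(p 0 ^ 2 + p 1 ^ 2)))) p
    fun_prop

theorem hasDerivWithinAt_plane {f g : ℝ → ℝ} {f' g' t : ℝ} {s : Set ℝ}
    (hf : HasDerivWithinAt f f' s t) (hg : HasDerivWithinAt g g' s t) :
    HasDerivWithinAt (fun t => (!₂[f t, g t] : Plane)) !₂[f', g'] s t := by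
  rw [hasDerivWithinAt_iff_hasFDerivWithinAt, hasFDerivWithinAt_piLp]
  intro i
  refine HasFDerivWithinAt.congr_fderiv (f' := ContinuousLinearMap.toSpanSingleton ℝ
    ((!₂[f', g'] : Plane) i)) ?_ (by ext; simp)
  rw [← hasDerivWithinAt_iff_hasFDerivWithinAt]
  fin_cases i
  · exact hf
  · exact hg

/-- A curve that solves the equations of motion in elliptic coordinates is an orbit. -/
theorem hasDerivWithinAt_ellipticPoint (hμ : 0 < μ) (hlam : 0 < lam) (he : 0 < e) (he1 : e < 1)
    {P V : ℝ → ℝ} {s : Set ℝ} {t : ℝ} (hP0 : e < P t)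
    (hP : HasDerivWithinAt P (-(P t - 1) * radialRate μ lam e (P t) (V t)) s t)
    (hV : HasDerivWithinAt V (angularRate μ lam e (P t) (V t)) s t) :
    HasDerivWithinAt (fun t => ellipticPoint (semiMajor μ lam) e (P t) (V t))
      (drift μ lam e (ellipticPoint (semiMajor μ lam) e (P t) (V t))) s t := by
  have h0 : P t ≠ 0 := (he.trans hP0).ne'
  rw [drift_ellipticPoint hμ hlam he he1 hP0]
  generalize radialRate μ lam e (P t) (V t) = G at *
  generalize angularRate μ lam e (P t) (V t) = H at *
  have hinv := (hasDerivWithinAt_const t s (e ^ 2)).div hP h0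
  have hx := ((((hP.add hinv).sub_const 2).const_mul e).add
      (((hP.add hinv).sub_const (2 * e ^ 2)).mul hV.cos)).const_mul (semiMajor μ lam)
  have hy := ((hP.sub hinv).const_mul (semiMajor μ lam)).mul hV.sin
  refine hasDerivWithinAt_plane ((hx.div_const (1 - e ^ 2)).congr_deriv ?_)
    ((hy.div_const (√(1 - e ^ 2))).congr_deriv ?_)
  · simp only [Pi.add_apply, Pi.div_apply]
    field_simp
    ring
  · simp only [Pi.sub_apply, Pi.div_apply]
    field_simp
    ring

end

/-! ### Compactness for functions of a radius and an angle. -/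

section Periodic

variable {X : Type*} {f : ℝ × ℝ → X}

theorem exists_shift_mem_Ico (v : ℝ) : ∃ k : ℤ, v - k * (2 * Real.pi) ∈ Ico 0 (2 * Real.pi) :=
  ⟨⌊v / (2 * Real.pi)⌋, Int.sub_floor_div_mul_nonneg v Real.two_pi_pos,
    Int.sub_floor_div_mul_lt v Real.two_pi_pos⟩

theorem periodic_shift (hper : ∀ ρ, Function.Periodic (fun v => f (ρ, v)) (2 * Real.pi))
    (ρ v : ℝ) (k : ℤ) : f (ρ, v - k * (2 * Real.pi)) = f (ρ, v) :=
  (hper ρ).sub_int_mul_eq k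

theorem isCompact_image_of_periodic [TopologicalSpace X] {I : Set ℝ} (hI : IsCompact I)
    (hf : ContinuousOn f (I ×ˢ univ))
    (hper : ∀ ρ, Function.Periodic (fun v => f (ρ, v)) (2 * Real.pi)) :
    IsCompact (f '' (I ×ˢ univ)) := by
  have h : f '' (I ×ˢ univ) = f '' (I ×ˢ Icc 0 (2 * Real.pi)) := by
    refine Subset.antisymm ?_ (image_mono (prod_mono_right (subset_univ _)))
    rintro _ ⟨⟨ρ, v⟩, ⟨hρ, -⟩, rfl⟩
    obtain ⟨k, hk⟩ := exists_shift_mem_Ico v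
    exact ⟨(ρ, v - k * (2 * Real.pi)), ⟨hρ, Ico_subset_Icc_self hk⟩, periodic_shift hper ρ v k⟩
  rw [h]
  exact (hI.prod isCompact_Icc).image_of_continuousOn
    (hf.mono (prod_mono_right (subset_univ _)))

theorem exists_abs_le_of_periodic {f : ℝ × ℝ → ℝ} {I : Set ℝ} (hI : IsCompact I)
    (hf : ContinuousOn f (I ×ˢ univ))
    (hper : ∀ ρ, Function.Periodic (fun v => f (ρ, v)) (2 * Real.pi)) :
    ∃ C, 0 ≤ C ∧ ∀ ρ ∈ I, ∀ v, |f (ρ, v)| ≤ C := by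
  obtain ⟨C, hC⟩ := (isCompact_image_of_periodic hI hf hper).isBounded.exists_norm_le
  exact ⟨max C 0, le_max_right _ _, fun ρ hρ v =>
    (hC _ ⟨(ρ, v), ⟨hρ, mem_univ _⟩, rfl⟩).trans (le_max_left _ _)⟩

theorem exists_pos_le_of_periodic {f : ℝ × ℝ → ℝ} {I : Set ℝ} (hI : IsCompact I)
    (hf : ContinuousOn f (I ×ˢ univ))
    (hper : ∀ ρ, Function.Periodic (fun v => f (ρ, v)) (2 * Real.pi))
    (hpos : ∀ ρ ∈ I, ∀ v, 0 < f (ρ, v)) :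
    ∃ δ, 0 < δ ∧ ∀ ρ ∈ I, ∀ v, δ ≤ f (ρ, v) := by
  -- A bound for `1 / f` gives a positive lower bound for `f`; adding 1 to it avoids inverting 0.
  obtain ⟨C, hC, h⟩ := exists_abs_le_of_periodic hI (f := fun p => (f p)⁻¹)
    (hf.inv₀ fun p hp => (hpos p.1 hp.1 p.2).ne') fun ρ v => congrArg _ (hper ρ v)
  refine ⟨(C + 1)⁻¹, by positivity, fun ρ hρ v => ?_⟩
  have h1 := hpos ρ hρ v
  have h2 := (le_abs_self _).trans (h ρ hρ v)
  exact inv_le_of_inv_le₀ h1 (h2.trans (by linarith))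

/-- A continuous function of a radius and an angle takes nearby values at nearby points. -/
theorem tendsto_dist_of_periodic [PseudoMetricSpace X] {I : Set ℝ} (hI : IsCompact I)
    (hf : ContinuousOn f (I ×ˢ univ))
    (hper : ∀ ρ, Function.Periodic (fun v => f (ρ, v)) (2 * Real.pi))
    {ι : Type*} {l : Filter ι} {P V W : ι → ℝ} {c : ℝ} (hc : c ∈ I) (hPI : ∀ᶠ t in l, P t ∈ I)
    (hP : Tendsto P l (𝓝 c)) (hVW : Tendsto (fun t => V t - W t) l (𝓝 0)) :
    Tendsto (fun t => dist (f (P t, V t)) (f (c, W t))) l (𝓝 0) := by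
  have huc := (hI.prod (isCompact_Icc (a := (-1 : ℝ)) (b := 2 * Real.pi
    + 1))).uniformContinuousOn_of_continuous (hf.mono (prod_mono_right (subset_univ _)))
  rw [Metric.uniformContinuousOn_iff] at huc
  rw [Metric.tendsto_nhds]
  intro ε hε
  obtain ⟨δ, hδ, h⟩ := huc ε hε
  filter_upwards [hPI, Metric.tendsto_nhds.1 hP δ hδ,
    Metric.tendsto_nhds.1 hVW (min δ 1) (by positivity)] with t h1 h2 h3
  rw [Real.dist_0_eq_abs, abs_of_nonneg dist_nonneg]
  rw [Real.dist_0_eq_abs, lt_min_iff] at h3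
  -- One common shift brings `W` into `[0, 2π)` and preserves `V - W`; as `|V - W| < 1`, both angles
  -- lie in `[-1, 2π + 1]`.
  obtain ⟨k, hk⟩ := exists_shift_mem_Ico (W t)
  have h4 := abs_lt.1 h3.2
  rw [← periodic_shift hper _ (V t) k, ← periodic_shift hper _ (W t) k]
  refine h _ ⟨h1, by linarith [hk.1], by linarith [hk.2]⟩ _
    ⟨hc, by linarith [hk.1], by linarith [hk.2]⟩ ?_
  rw [Prod.dist_eq]
  refine max_lt h2 ?_
  rw [Real.dist_eq, sub_sub_sub_cancel_right]
  exact h3.1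

end Periodic

/-! ### Global existence and exponential decay in elliptic coordinates. -/

section Flow

variable {μ lam e ρ ρ₀ v : ℝ}

theorem contDiffAt_radialRate (he : 0 < e) (he1 : e < 1) {p : ℝ × ℝ} (hp : e < p.1) :
    ContDiffAt ℝ 1 (fun p : ℝ × ℝ => radialRate μ lam e p.1 p.2) p := by
  have h := mul_pos (radiusNum_pos (v := p.2) he he1 hp) (sqNormAdd_pos (v := p.2) he hp)
  unfold radialRate
  refine ContDiffAt.div (by fun_prop) ?_ h.ne'
  unfold radiusNum sqNormAdd
  fun_prop

theorem contDiffAt_angularRate (he : 0 < e) (he1 : e < 1) {p : ℝ × ℝ} (hp : e < p.1) :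
    ContDiffAt ℝ 1 (fun p : ℝ × ℝ => angularRate μ lam e p.1 p.2) p := by
  have h := mul_pos (radiusNum_pos (v := p.2) he he1 hp) (sqNormAdd_pos (v := p.2) he hp)
  unfold angularRate
  refine ContDiffAt.div (by fun_prop) ?_ h.ne'
  unfold radiusNum sqNormAdd
  fun_prop

theorem periodic_radialRate (ρ : ℝ) :
    Function.Periodic (fun v => radialRate μ lam e ρ v) (2 * Real.pi) := fun v => by
  simp [radialRate, radiusNum, sqNormAdd]

theorem periodic_angularRate (ρ : ℝ) :
    Function.Periodic (fun v => angularRate μ lam e ρ v) (2 * Real.pi) := fun v => by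
  simp [angularRate, radiusNum, sqNormAdd]

/-- The threshold `√2 e` arises here, as the maximum of `e (sin v - cos v)`. -/
theorem radialRate_pos (hμ : 0 < μ) (hlam : 0 < lam) (he : 0 < e) (he1 : e < 1)
    (hρ : √2 * e < ρ) : 0 < radialRate μ lam e ρ v := by
  have hρe : e < ρ := by nlinarith [sqrt_two_bounds.1]
  have hρ0 := he.trans hρe
  have hs := one_sub_sq_pos he he1
  have hN := radiusNum_pos (v := v) he he1 hρe
  have hq := sqNormAdd_pos (v := v) he hρe
  have hcs : Real.sin v - Real.cos v ≤ √2 := by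
    refine Real.le_sqrt_of_sq_le ?_
    nlinarith [Real.sin_sq_add_cos_sq v, sq_nonneg (Real.sin v + Real.cos v)]
  have : 0 < ρ + e * Real.cos v - e * Real.sin v := by nlinarith
  unfold radialRate
  positivity

theorem lt_of_mem_uIcc (he' : e < 1 / √2) (hρ₀ : √2 * e < ρ₀)
    (hρ : ρ ∈ uIcc 1 ρ₀) : √2 * e < ρ :=
  (lt_min (sqrt_two_mul_lt_one he') hρ₀).trans_le hρ.1

theorem lt_of_sqrt_two_mul_lt (he : 0 < e) (hρ : √2 * e < ρ) : e < ρ := by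
  nlinarith [sqrt_two_bounds.1]

/-- In elliptic coordinates the orbits exist for all future times, and `ρ - 1` decays
exponentially. -/
theorem exists_elliptic_orbit (hμ : 0 < μ) (hlam : 0 < lam) (he : 0 < e) (he' : e < 1 / √2)
    (hρ₀ : √2 * e < ρ₀) (t₀ v₀ : ℝ) :
    ∃ P V : ℝ → ℝ, P t₀ = ρ₀ ∧ V t₀ = v₀ ∧
      (∀ t ∈ Ici t₀, P t ∈ uIcc 1 ρ₀) ∧
      (∀ t ∈ Ici t₀, HasDerivWithinAt P (-(P t - 1) * radialRate μ lam e (P t) (V t)) (Ici t₀) t) ∧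
      (∀ t ∈ Ici t₀, HasDerivWithinAt V (angularRate μ lam e (P t) (V t)) (Ici t₀) t) ∧
      ∃ δ, 0 < δ ∧ ∀ t ∈ Ici t₀, |P t - 1| ≤ |ρ₀ - 1| * Real.exp (-δ * (t - t₀)) := by
  have he1 := lt_one_of_lt he' he
  have hIe : ∀ ρ ∈ uIcc 1 ρ₀, e < ρ := fun ρ hρ =>
    lt_of_sqrt_two_mul_lt he (lt_of_mem_uIcc he' hρ₀ hρ)
  have hGc : ContinuousOn (fun p : ℝ × ℝ => radialRate μ lam e p.1 p.2) (uIcc 1 ρ₀ ×ˢ univ) :=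
    fun p hp => (contDiffAt_radialRate he he1 (hIe _ hp.1)).continuousAt.continuousWithinAt
  have hHc : ContinuousOn (fun p : ℝ × ℝ => angularRate μ lam e p.1 p.2) (uIcc 1 ρ₀ ×ˢ univ) :=
    fun p hp => (contDiffAt_angularRate he he1 (hIe _ hp.1)).continuousAt.continuousWithinAt
  obtain ⟨δ, hδ, hGδ⟩ := exists_pos_le_of_periodic isCompact_uIcc hGc periodic_radialRate
    fun ρ hρ v => radialRate_pos hμ hlam he he1 (lt_of_mem_uIcc he' hρ₀ hρ)
  obtain ⟨C₁, hC₁, hG⟩ := exists_abs_le_of_periodic isCompact_uIcc hGc periodic_radialRate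
  obtain ⟨C₂, hC₂, hH⟩ := exists_abs_le_of_periodic isCompact_uIcc hHc periodic_angularRate
  -- Substituting `ρ = 1 + (ρ₀ - 1) exp (-σ)` turns the radial equation into `σ' = radialRate`. The
  -- clamp `max σ 0` keeps `ρ` between 1 and `ρ₀`, so the field is bounded and locally Lipschitz
  -- everywhere.
  let R : ℝ → ℝ := fun σ => 1 + (ρ₀ - 1) * Real.exp (-max σ 0)
  have hR : ∀ σ, R σ ∈ uIcc 1 ρ₀ := by
    intro σ
    have h1 : Real.exp (-max σ 0) ≤ 1 := Real.exp_le_one_iff.2 (by simp)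
    have h0 := Real.exp_pos (-max σ 0)
    rw [mem_uIcc]
    rcases le_total 1 ρ₀ with h | h
    · exact Or.inl ⟨by simp only [R]; nlinarith, by simp only [R]; nlinarith⟩
    · exact Or.inr ⟨by simp only [R]; nlinarith, by simp only [R]; nlinarith⟩
  have hmax : LocallyLipschitz fun σ : ℝ => max σ 0 :=
    (LipschitzWith.id.max_const 0).locallyLipschitz
  have hexp : ContDiff ℝ 1 fun m : ℝ => 1 + (ρ₀ - 1) * Real.exp (-m) := by fun_prop
  have hRL : LocallyLipschitz R := hexp.locallyLipschitz.comp hmax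
  let F : ℝ × ℝ → ℝ × ℝ := fun p => (radialRate μ lam e p.1 p.2, angularRate μ lam e p.1 p.2)
  let g : ℝ × ℝ → ℝ × ℝ := fun p => (R p.1, p.2)
  have hg : LocallyLipschitz g :=
    (hRL.comp LipschitzWith.prod_fst.locallyLipschitz).prodMk
      LipschitzWith.prod_snd.locallyLipschitz
  have hFg : LocallyLipschitz (F ∘ g) := locallyLipschitz_comp_of_contDiffAt hg fun p =>
    (contDiffAt_radialRate he he1 (hIe _ (hR p.1))).prodMk
      (contDiffAt_angularRate he he1 (hIe _ (hR p.1)))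
  obtain ⟨γ, hγ0, hγ⟩ := exists_isIntegralCurveOn_Ici hFg (L := max C₁ C₂) (fun p =>
    max_le_max (hG _ (hR p.1) p.2) (hH _ (hR p.1) p.2)) t₀ (0, v₀)
  have hσ : ∀ t ∈ Ici t₀, HasDerivWithinAt (fun t => (γ t).1)
      (radialRate μ lam e (R (γ t).1) (γ t).2) (Ici t₀) t := fun t ht => (hγ t ht).fst
  have hV : ∀ t ∈ Ici t₀, HasDerivWithinAt (fun t => (γ t).2)
      (angularRate μ lam e (R (γ t).1) (γ t).2) (Ici t₀) t := fun t ht => (hγ t ht).snd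
  have hσ' : ∀ t ∈ interior (Ici t₀), HasDerivAt (fun t => (γ t).1)
      (radialRate μ lam e (R (γ t).1) (γ t).2) t := fun t ht =>
    (hσ t (interior_subset ht)).hasDerivAt (mem_interior_iff_mem_nhds.1 ht)
  have hσδ : ∀ t ∈ Ici t₀, δ * (t - t₀) ≤ (γ t).1 := by
    intro t ht
    have := (convex_Ici t₀).mul_sub_le_image_sub_of_le_deriv
      (fun t ht => (hσ t ht).continuousWithinAt)
      (fun t ht => (hσ' t ht).differentiableAt.differentiableWithinAt)
      (C := δ) (fun t ht => by rw [(hσ' t ht).deriv]; exact hGδ _ (hR _) _)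
      t₀ self_mem_Ici t ht ht
    simpa [hγ0] using this
  -- `σ` starts at 0 and increases at rate at least `δ`, so the clamp is never active after `t₀`.
  have hσ0 : ∀ t ∈ Ici t₀, 0 ≤ (γ t).1 := fun t ht =>
    (mul_nonneg hδ.le (sub_nonneg.2 ht)).trans (hσδ t ht)
  have hRσ : ∀ t ∈ Ici t₀, R (γ t).1 = 1 + (ρ₀ - 1) * Real.exp (-(γ t).1) := fun t ht => by
    simp only [R, max_eq_left (hσ0 t ht)]
  refine ⟨fun t => R (γ t).1, fun t => (γ t).2, by simp [R, hγ0], by simp [hγ0],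
    fun t _ => hR _, fun t ht => ?_, hV, δ, hδ, fun t ht => ?_⟩
  · refine ((((hσ t ht).neg.exp.const_mul (ρ₀ - 1)).const_add 1).congr_deriv ?_).congr
      hRσ (hRσ t ht)
    simp only [Pi.neg_apply]
    linear_combination radialRate μ lam e (R (γ t).1) (γ t).2 * hRσ t ht
  · simp only [hRσ t ht, add_sub_cancel_left, abs_mul, Real.abs_exp]
    gcongr
    linarith [hσδ t ht]

end Flow

/-! ### Kepler's equation and the motion on the Kepler ellipse. -/

section Kepler

/-- Kepler's function, which sends the eccentric anomaly to the mean anomaly. -/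
def meanAnomaly (e v : ℝ) : ℝ := v - e * Real.sin v

variable {μ lam a e ρ v : ℝ}

theorem one_sub_mul_cos_pos (he : 0 < e) (he1 : e < 1) (v : ℝ) : 0 < 1 - e * Real.cos v := by
  nlinarith [Real.cos_le_one v]

theorem hasDerivAt_meanAnomaly (e v : ℝ) :
    HasDerivAt (meanAnomaly e) (1 - e * Real.cos v) v :=
  (hasDerivAt_id v).sub ((Real.hasDerivAt_sin v).const_mul e)

theorem continuous_meanAnomaly (e : ℝ) : Continuous (meanAnomaly e) :=
  continuous_iff_continuousAt.2 fun v => (hasDerivAt_meanAnomaly e v).continuousAt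

theorem strictMono_meanAnomaly (he : 0 < e) (he1 : e < 1) : StrictMono (meanAnomaly e) :=
  strictMono_of_deriv_pos fun v => by
    rw [(hasDerivAt_meanAnomaly e v).deriv]
    exact one_sub_mul_cos_pos he he1 v

theorem surjective_meanAnomaly (he : 0 < e) : Function.Surjective (meanAnomaly e) := by
  refine (continuous_meanAnomaly e).surjective ?_ ?_
  · refine tendsto_atTop_mono (f := fun v => v - e) (fun v => ?_) ?_
    · unfold meanAnomaly
      nlinarith [Real.sin_le_one v]
    · exact tendsto_atTop_add_const_right _ (-e) tendsto_id
  · refine tendsto_atBot_mono (f := fun v => v + e) (fun v => ?_) ?_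
    · unfold meanAnomaly
      nlinarith [Real.neg_one_le_sin v]
    · exact tendsto_atBot_add_const_right _ e tendsto_id

/-- The sine is 1-Lipschitz. This turns convergence of mean anomalies into convergence of eccentric
anomalies. -/
theorem mul_abs_sub_le_abs_meanAnomaly_sub (he : 0 < e) (v w : ℝ) :
    (1 - e) * |v - w| ≤ |meanAnomaly e v - meanAnomaly e w| := by
  have h1 := Real.abs_sin_sub_sin_le v w
  have h2 : v - w = (meanAnomaly e v - meanAnomaly e w) + e * (Real.sin v - Real.sin w) := by
    unfold meanAnomaly; ring
  have h3 : |v - w| ≤ |meanAnomaly e v - meanAnomaly e w| + |e * (Real.sin v - Real.sin w)| := by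
    conv_lhs => rw [h2]
    exact abs_add_le _ _
  rw [abs_mul, abs_of_pos he] at h3
  nlinarith

/-- The solution of Kepler's equation. -/
theorem exists_inverse_meanAnomaly (he : 0 < e) (he1 : e < 1) :
    ∃ K : ℝ → ℝ, (∀ m, meanAnomaly e (K m) = m) ∧
      ∀ m, HasDerivAt K (1 - e * Real.cos (K m))⁻¹ m := by
  let O := (strictMono_meanAnomaly he he1).orderIsoOfSurjective _ (surjective_meanAnomaly he)
  refine ⟨O.symm, fun m => O.apply_symm_apply m, fun m => ?_⟩
  exact (hasDerivAt_meanAnomaly e (O.symm m)).of_local_left_inverse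
    O.symm.continuous.continuousAt (one_sub_mul_cos_pos he he1 _).ne'
    (Eventually.of_forall fun m => O.apply_symm_apply m)

/-- The reciprocal of the mean motion in terms of the angular momentum `lam`. -/
theorem sqrt_semiMajor_cube_div (hμ : 0 < μ) (hlam : 0 < lam) :
    √(semiMajor μ lam ^ 3 / μ) = (μ ^ 2 / lam ^ 3)⁻¹ := by
  rw [show semiMajor μ lam ^ 3 / μ = ((μ ^ 2 / lam ^ 3)⁻¹) ^ 2 by
    unfold semiMajor; field_simp, Real.sqrt_sq (by positivity)]

theorem ellipticPoint_one_zero (he : 0 < e) (he1 : e < 1) :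
    ellipticPoint a e 1 v 0 = a * (Real.cos v - e) := by
  have hs := one_sub_sq_pos he he1
  rw [ellipticPoint_zero]
  field_simp
  ring

theorem ellipticPoint_one_one (he : 0 < e) (he1 : e < 1) :
    ellipticPoint a e 1 v 1 = a * √(1 - e ^ 2) * Real.sin v := by
  have hs := one_sub_sq_pos he he1
  have hs0 := Real.sqrt_pos.2 hs
  have hs1 : √(1 - e ^ 2) ^ 2 = 1 - e ^ 2 := Real.sq_sqrt hs.le
  rw [ellipticPoint_one, div_eq_iff hs0.ne']
  linear_combination -a * Real.sin v * hs1

theorem ellipticPoint_one_eq (he : 0 < e) (he1 : e < 1) : ellipticPoint a e 1 v =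
    !₂[a * (Real.cos v - e), a * √(1 - e ^ 2) * Real.sin v] := by
  ext i
  fin_cases i
  · exact ellipticPoint_one_zero he he1
  · exact ellipticPoint_one_one he he1

theorem radiusNum_one (e v : ℝ) : radiusNum e 1 v = (1 - e ^ 2) * (1 - e * Real.cos v) := by
  unfold radiusNum; ring

theorem norm_ellipticPoint_one (ha : 0 < a) (he : 0 < e) (he1 : e < 1) :
    ‖ellipticPoint a e 1 v‖ = a * (1 - e * Real.cos v) := by
  have hs := one_sub_sq_pos he he1
  rw [← dist_zero_right, dist_zero_plane, sqrt_ellipticPoint ha he he1 he1.le, radiusNum_one]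
  field_simp

theorem angularRate_one (he : 0 < e) (he1 : e < 1) :
    angularRate μ lam e 1 v = μ ^ 2 / lam ^ 3 * (1 - e * Real.cos v)⁻¹ := by
  have hs := one_sub_sq_pos he he1
  have h := one_sub_mul_cos_pos he he1 v
  have hq := sqNormAdd_pos (v := v) he he1
  rw [angularRate, radiusNum_one, show (1 + e ^ 2 + e * Real.cos v * (1 + 1) -
    e * Real.sin v * (1 - 1)) = sqNormAdd e 1 v by unfold sqNormAdd; ring]
  field_simp

/-- The Kepler ellipse is the coordinate line `ρ = 1`. -/
theorem keplerEllipse_eq_range (ha : 0 < a) (he : 0 < e) (he1 : e < 1) :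
    keplerEllipse a e = range (ellipticPoint a e 1) := by
  have hs := one_sub_sq_pos he he1
  have hA : ellipseAxis a e e = a := by unfold ellipseAxis; field_simp; ring
  have hiff : ∀ ρ v, e ≤ ρ → (ellipticPoint a e ρ v ∈ keplerEllipse a e ↔ ρ = 1) := by
    intro ρ v hρ
    have hρ0 := he.trans_le hρ
    obtain ⟨m, hm, h⟩ := exists_pos_mul_focal_sum ha he he he1 (ellipticPoint a e ρ v)
    have hpos : 0 < 1 + e ^ 2 + 2 * e * Real.cos v := by
      nlinarith [sq_pos_of_pos (sub_pos.2 he1), Real.neg_one_le_cos v]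
    -- The other root `ρ = e²` is the mirror of 1 under `ρ ↦ e² / ρ` and lies below `e`.
    have hpos' : 0 < ρ - e ^ 2 := by nlinarith
    have h2 : dist (ellipticPoint a e ρ v) 0 + e * ellipticPoint a e ρ v 0 - a * (1 - e ^ 2) =
        a / (1 - e ^ 2) * (1 + e ^ 2 + 2 * e * Real.cos v) * ((ρ - e ^ 2) / ρ) * (ρ - 1) := by
      rw [dist_zero_plane, sqrt_ellipticPoint ha he he1 hρ, ellipticPoint_zero, radiusNum]
      field_simp
      ring
    rw [hA, h2] at h
    rw [keplerEllipse, ellipse, mem_ofPred_eq, hA, ← sub_eq_zero, ← sub_eq_zero (a := ρ)]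
    constructor
    · intro h0
      rw [h0, mul_zero, eq_comm, mul_eq_zero] at h
      exact h.resolve_left (by positivity)
    · intro h0
      rw [h0, mul_zero, mul_eq_zero] at h
      exact h.resolve_left hm.ne'
  ext p
  constructor
  · intro hp
    obtain ⟨ρ, v, hρ, rfl⟩ := exists_eq_ellipticPoint ha he he1 p
    rw [hiff ρ v hρ] at hp
    exact ⟨v, by rw [hp]⟩
  · rintro ⟨v, rfl⟩
    exact (hiff 1 v he1.le).2 rfl

theorem periodic_ellipticPoint (a e ρ : ℝ) :
    Function.Periodic (ellipticPoint a e ρ) (2 * Real.pi) := fun v => by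
  simp [ellipticPoint]

theorem ellipticPoint_one_eq_iff (ha : 0 < a) (he : 0 < e) (he1 : e < 1) {v w : ℝ} :
    ellipticPoint a e 1 v = ellipticPoint a e 1 w ↔ ∃ k : ℤ, v = w + k * (2 * Real.pi) := by
  have hs0 := Real.sqrt_pos.2 (one_sub_sq_pos he he1)
  constructor
  · intro h
    have h0 := congrArg (fun p : Plane => p 0) h
    have h1 := congrArg (fun p : Plane => p 1) h
    simp only [ellipticPoint_one_zero he he1, ellipticPoint_one_one he he1] at h0 h1
    have hc : Real.cos v = Real.cos w := by linarith [mul_left_cancel₀ ha.ne' h0]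
    have hsn : Real.sin v = Real.sin w := mul_left_cancel₀ (by positivity) h1
    have hang : (v : Real.Angle) = w := Real.Angle.cos_sin_inj hc hsn
    obtain ⟨k, hk⟩ := Real.Angle.angle_eq_iff_two_pi_dvd_sub.1 hang
    exact ⟨k, by linarith⟩
  · rintro ⟨k, rfl⟩
    exact (periodic_ellipticPoint a e 1).int_mul k w

theorem meanAnomaly_add_int_mul (e v : ℝ) (k : ℤ) :
    meanAnomaly e (v + k * (2 * Real.pi)) = meanAnomaly e v + k * (2 * Real.pi) := by
  simp only [meanAnomaly, Real.sin_add_int_mul_two_pi]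
  ring

/-- The motion on the Kepler ellipse whose mean anomaly is `n t + τ` is Keplerian, and an orbit of
the system. -/
theorem kepler_motion (hμ : 0 < μ) (hlam : 0 < lam) (he : 0 < e) (he1 : e < 1) {W : ℝ → ℝ} (τ : ℝ)
    (hW : ∀ t, meanAnomaly e (W t) = μ ^ 2 / lam ^ 3 * t + τ)
    (hW' : ∀ t, HasDerivAt W (μ ^ 2 / lam ^ 3 * (1 - e * Real.cos (W t))⁻¹) t) :
    IsOrbitOn μ lam e univ (fun t => ellipticPoint (semiMajor μ lam) e 1 (W t)) ∧
      IsKeplerianMotion μ (semiMajor μ lam) e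
        (fun t => ellipticPoint (semiMajor μ lam) e 1 (W t)) := by
  have ha := semiMajor_pos hμ hlam
  have hs := one_sub_sq_pos he he1
  have hs0 := Real.sqrt_pos.2 hs
  have hs1 : √(1 - e ^ 2) ^ 2 = 1 - e ^ 2 := Real.sq_sqrt hs.le
  have hn : 0 < μ ^ 2 / lam ^ 3 := by positivity
  have hcp := fun t => one_sub_mul_cos_pos he he1 (W t)
  have hinj := (strictMono_meanAnomaly he he1).injective
  have hy' : ∀ t, HasDerivAt (fun t => ellipticPoint (semiMajor μ lam) e 1 (W t))
      !₂[-(μ / lam) * (Real.sin (W t) * (1 - e * Real.cos (W t))⁻¹),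
        μ / lam * √(1 - e ^ 2) * (Real.cos (W t) * (1 - e * Real.cos (W t))⁻¹)] t := by
    intro t
    have h1 := (((hW' t).cos.sub_const e).const_mul (semiMajor μ lam))
    have h2 := ((hW' t).sin.const_mul (semiMajor μ lam * √(1 - e ^ 2)))
    have h3 := hasDerivWithinAt_plane h1.hasDerivWithinAt h2.hasDerivWithinAt (s := univ)
    rw [hasDerivWithinAt_univ] at h3
    have hc := hcp t
    refine (h3.congr_deriv ?_).congr_of_eventuallyEq
      (Eventually.of_forall fun t => ellipticPoint_one_eq he he1)
    congr 2
    · unfold semiMajor; field_simp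
    · congr 1
      unfold semiMajor; field_simp
  have hder : deriv (fun t => ellipticPoint (semiMajor μ lam) e 1 (W t)) = fun t =>
      !₂[-(μ / lam) * (Real.sin (W t) * (1 - e * Real.cos (W t))⁻¹),
        μ / lam * √(1 - e ^ 2) * (Real.cos (W t) * (1 - e * Real.cos (W t))⁻¹)] :=
    funext fun t => (hy' t).deriv
  refine ⟨?_, fun t => (hy' t).differentiableAt, ?_, ?_, ?_, ?_, ?_⟩
  · intro t _
    refine hasDerivWithinAt_ellipticPoint hμ hlam he he1 (P := fun _ => 1) he1 ?_ ?_
    · simpa using hasDerivWithinAt_const t univ (1 : ℝ)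
    · rw [angularRate_one he he1]
      exact (hW' t).hasDerivWithinAt
  · intro t
    have hc := hcp t
    have hinv := ((hW' t).cos.const_mul e).const_sub 1 |>.inv hc.ne'
    have h1 := ((hW' t).sin.mul hinv).const_mul (-(μ / lam))
    have h2 := ((hW' t).cos.mul hinv).const_mul (μ / lam * √(1 - e ^ 2))
    have h3 := hasDerivWithinAt_plane h1.hasDerivWithinAt h2.hasDerivWithinAt (s := univ)
    rw [hasDerivWithinAt_univ] at h3
    rw [hder, norm_ellipticPoint_one ha he he1, ellipticPoint_one_eq he he1]
    refine h3.congr_deriv ?_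
    have hsc := Real.sin_sq (W t)
    ext i
    fin_cases i
    · simp [semiMajor]
      field_simp
      rw [hsc]
      ring
    · simp [semiMajor]
      field_simp
      ring
  · intro t
    have hc := hcp t
    rw [hder, norm_ellipticPoint_one ha he he1, EuclideanSpace.norm_sq_eq, Fin.sum_univ_two]
    simp only [Real.norm_eq_abs, sq_abs]
    simp [semiMajor]
    have hsc := Real.sin_sq (W t)
    simp only [mul_pow, hs1, hsc]
    generalize hd : 1 - e * Real.cos (W t) = d at hc ⊢
    field_simp
    rw [← hd]
    ring
  · rw [keplerEllipse_eq_range ha he he1]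
    refine Subset.antisymm (by rintro _ ⟨t, rfl⟩; exact ⟨W t, rfl⟩) ?_
    rintro _ ⟨v, rfl⟩
    refine ⟨(meanAnomaly e v - τ) / (μ ^ 2 / lam ^ 3), ?_⟩
    have : W ((meanAnomaly e v - τ) / (μ ^ 2 / lam ^ 3)) = v := hinj (by rw [hW]; field_simp; ring)
    simp only [this]
  · intro t
    have hc := hcp t
    rw [hder, ellipticPoint_one_eq he he1, Real.sqrt_mul (by positivity),
      show μ * semiMajor μ lam = lam ^ 2 by unfold semiMajor; field_simp, Real.sqrt_sq hlam.le]
    simp [semiMajor]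
    have hsc := Real.sin_sq (W t)
    generalize hd : 1 - e * Real.cos (W t) = d at hc ⊢
    field_simp
    rw [hsc, ← hd]
    ring
  · intro s t
    rw [ellipticPoint_one_eq_iff ha he he1, sqrt_semiMajor_cube_div hμ hlam]
    refine exists_congr fun k => ?_
    -- The mean anomaly is injective and commutes with shifts by `2π`, so a turn in `v` is a shift
    -- by `2π / n` in time.
    rw [← hinj.eq_iff, meanAnomaly_add_int_mul, hW, hW]
    constructor
    · intro h
      field_simp at h ⊢
      linarith
    · rintro rfl
      field_simp
      ring

end Kepler

/-! ### Convergence of the phase. -/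

section Phase

variable {μ lam e ρ₀ t₀ : ℝ} {P V : ℝ → ℝ}

/-- The deviation of the rate of change of the mean anomaly from the mean motion, divided by
`ρ - 1`. -/
def phaseDefect (μ lam e ρ v : ℝ) : ℝ :=
  μ ^ 2 / lam ^ 3 *
      (-(1 + e * Real.cos v) * ρ ^ 3
        + (-(1 + e * Real.cos v) + 2 * e ^ 2 * (1 - Real.cos v ^ 2)) * ρ ^ 2
        + (-(1 + e * Real.cos v) + 2 * e ^ 2 * (1 - Real.cos v ^ 2)
            + (1 - e ^ 2 * Real.cos v ^ 2) * (1 - e ^ 2) - 2 * e ^ 2 * (1 + e * Real.cos v)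
            + 4 * e ^ 2 * Real.cos v * (e + Real.cos v)) * ρ
        + e ^ 4 * (1 + e * Real.cos v)
        - (1 - e * Real.cos v) * (1 - e ^ 2) * ρ * e * Real.sin v) /
    (radiusNum e ρ v * sqNormAdd e ρ v)

/-- The left side vanishes at `ρ = 1`, where the motion is Keplerian; `phaseDefect` is the quotient
by `ρ - 1`, and its denominator has no zeros for `ρ > e`. -/
theorem mul_angularRate_sub (he : 0 < e) (he1 : e < 1) {ρ : ℝ} (v : ℝ) (hρ : e < ρ) :
    (1 - e * Real.cos v) * angularRate μ lam e ρ v - μ ^ 2 / lam ^ 3 =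
      (ρ - 1) * phaseDefect μ lam e ρ v := by
  have hN := (radiusNum_pos (v := v) he he1 hρ).ne'
  have hq := (sqNormAdd_pos (v := v) he hρ).ne'
  rw [angularRate, phaseDefect]
  generalize μ ^ 2 / lam ^ 3 = n
  field_simp
  unfold radiusNum sqNormAdd
  ring

theorem continuousOn_phaseDefect (he : 0 < e) (he1 : e < 1) {I : Set ℝ} (hI : ∀ ρ ∈ I, e < ρ) :
    ContinuousOn (fun p : ℝ × ℝ => phaseDefect μ lam e p.1 p.2) (I ×ˢ univ) := by
  unfold phaseDefect
  refine ContinuousOn.div (by fun_prop) ?_ fun p hp =>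
    (mul_pos (radiusNum_pos he he1 (hI _ hp.1)) (sqNormAdd_pos he (hI _ hp.1))).ne'
  unfold radiusNum sqNormAdd
  fun_prop

theorem periodic_phaseDefect (ρ : ℝ) :
    Function.Periodic (fun v => phaseDefect μ lam e ρ v) (2 * Real.pi) := fun v => by
  simp [phaseDefect, radiusNum, sqNormAdd]

/-- Along an orbit the mean anomaly is asymptotic to that of a Keplerian motion. -/
theorem exists_tendsto_phase (he : 0 < e) (he' : e < 1 / √2)
    (hρ₀ : √2 * e < ρ₀) (hPI : ∀ t ∈ Ici t₀, P t ∈ uIcc 1 ρ₀)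
    (hPc : ContinuousOn P (Ici t₀))
    (hV : ∀ t ∈ Ici t₀, HasDerivWithinAt V (angularRate μ lam e (P t) (V t)) (Ici t₀) t)
    {δ : ℝ} (hδ : 0 < δ)
    (hdecay : ∀ t ∈ Ici t₀, |P t - 1| ≤ |ρ₀ - 1| * Real.exp (-δ * (t - t₀))) :
    ∃ τ, Tendsto (fun t => meanAnomaly e (V t) - μ ^ 2 / lam ^ 3 * t) atTop (𝓝 τ) := by
  have he1 := lt_one_of_lt he' he
  have hIe : ∀ ρ ∈ uIcc 1 ρ₀, e < ρ := fun ρ hρ =>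
    lt_of_sqrt_two_mul_lt he (lt_of_mem_uIcc he' hρ₀ hρ)
  have hE := continuousOn_phaseDefect (μ := μ) (lam := lam) he he1 hIe
  obtain ⟨C, hC0, hC⟩ := exists_abs_le_of_periodic isCompact_uIcc hE periodic_phaseDefect
  have hderiv : ∀ t ∈ Ioi t₀, HasDerivAt (fun t => meanAnomaly e (V t) - μ ^ 2 / lam ^ 3 * t)
      ((P t - 1) * phaseDefect μ lam e (P t) (V t)) t := by
    intro t ht
    have ht' : t ∈ Ici t₀ := Ioi_subset_Ici_self ht
    have h1 := (hV t ht').hasDerivAt (Ici_mem_nhds ht)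
    have h2 := ((hasDerivAt_meanAnomaly e (V t)).comp t h1).sub
      ((hasDerivAt_id t).const_mul (μ ^ 2 / lam ^ 3))
    refine h2.congr_deriv ?_
    rw [mul_one, mul_angularRate_sub he he1 _ (hIe _ (hPI t ht'))]
  have hVc : ContinuousOn V (Ici t₀) := fun t ht => (hV t ht).continuousWithinAt
  have hcont : ContinuousOn (fun t => (P t - 1) * phaseDefect μ lam e (P t) (V t)) (Ioi t₀) :=
    ((hPc.sub continuousOn_const).mul
      (hE.comp (hPc.prodMk hVc) fun t ht => ⟨hPI t ht, mem_univ _⟩)).mono Ioi_subset_Ici_self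
  -- A function with integrable derivative has a limit at infinity; here the derivative is dominated
  -- by a multiple of `exp (-δ t)`.
  refine ⟨_, MeasureTheory.tendsto_limUnder_of_hasDerivAt_of_integrableOn_Ioi hderiv ?_⟩
  have hint : MeasureTheory.IntegrableOn
      (fun t => |ρ₀ - 1| * Real.exp (δ * t₀) * C * Real.exp (-δ * t)) (Ioi t₀) :=
    (exp_neg_integrableOn_Ioi t₀ hδ).const_mul _
  refine MeasureTheory.Integrable.mono' hint (hcont.aestronglyMeasurable measurableSet_Ioi) ?_
  refine (MeasureTheory.ae_restrict_iff' measurableSet_Ioi).2 (Eventually.of_forall fun t ht => ?_)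
  have ht' : t ∈ Ici t₀ := Ioi_subset_Ici_self ht
  have hexp : Real.exp (-δ * (t - t₀)) = Real.exp (δ * t₀) * Real.exp (-δ * t) := by
    rw [← Real.exp_add]
    ring_nf
  rw [Real.norm_eq_abs, abs_mul]
  calc |P t - 1| * |phaseDefect μ lam e (P t) (V t)|
      ≤ |ρ₀ - 1| * Real.exp (-δ * (t - t₀)) * C :=
        mul_le_mul (hdecay t ht') (hC _ (hPI t ht') _) (abs_nonneg _) (by positivity)
    _ = _ := by rw [hexp]; ring

end Phase

/-! ### Convergence to the Keplerian motion. -/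

section Settle

variable {μ lam e ρ₀ t₀ : ℝ}

theorem continuousOn_ellipticPoint (a : ℝ) (he : 0 < e) {I : Set ℝ} (hI : ∀ ρ ∈ I, e < ρ) :
    ContinuousOn (fun p : ℝ × ℝ => ellipticPoint a e p.1 p.2) (I ×ˢ univ) := by
  have h0 : ∀ p ∈ I ×ˢ (univ : Set ℝ), p.1 ≠ 0 := fun p hp => (he.trans (hI _ hp.1)).ne'
  have hd : ContinuousOn (fun p : ℝ × ℝ => e ^ 2 / p.1) (I ×ˢ univ) :=
    continuousOn_const.div continuousOn_fst h0
  refine (PiLp.continuous_toLp 2 _).comp_continuousOn (continuousOn_pi.2 fun i => ?_)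
  fin_cases i
  · change ContinuousOn (fun p : ℝ × ℝ => a * (e * (p.1 + e ^ 2 / p.1 - 2) +
      (p.1 + e ^ 2 / p.1 - 2 * e ^ 2) * Real.cos p.2) / (1 - e ^ 2)) _
    fun_prop
  · change ContinuousOn (fun p : ℝ × ℝ =>
      a * (p.1 - e ^ 2 / p.1) * Real.sin p.2 / √(1 - e ^ 2)) _
    fun_prop

/-- From each point of the exterior an orbit starts which exists for all times and settles down
to Keplerian motion. -/
theorem exists_settling_orbit (hμ : 0 < μ) (hlam : 0 < lam) (he : 0 < e) (he' : e < 1 / √2)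
    (hρ₀ : √2 * e < ρ₀) (t₀ v₀ : ℝ) :
    ∃ x : ℝ → Plane, IsOrbitOn μ lam e (Ici t₀) x ∧
      x t₀ = ellipticPoint (semiMajor μ lam) e ρ₀ v₀ ∧
      (∀ t ∈ Ici t₀, ∃ ρ v, √2 * e < ρ ∧ x t = ellipticPoint (semiMajor μ lam) e ρ v) ∧
      SettlesToKeplerian μ lam e x := by
  have he1 := lt_one_of_lt he' he
  have hIe : ∀ ρ ∈ uIcc 1 ρ₀, e < ρ := fun ρ hρ =>
    lt_of_sqrt_two_mul_lt he (lt_of_mem_uIcc he' hρ₀ hρ)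
  obtain ⟨P, V, hP0, hV0, hPI, hP, hV, δ, hδ, hdecay⟩ :=
    exists_elliptic_orbit hμ hlam he he' hρ₀ t₀ v₀
  have hx : IsOrbitOn μ lam e (Ici t₀)
      (fun t => ellipticPoint (semiMajor μ lam) e (P t) (V t)) := fun t ht =>
    hasDerivWithinAt_ellipticPoint hμ hlam he he1 (hIe _ (hPI t ht)) (hP t ht) (hV t ht)
  refine ⟨_, hx, by simp only [hP0, hV0], fun t ht =>
    ⟨P t, V t, lt_of_mem_uIcc he' hρ₀ (hPI t ht), rfl⟩, ?_⟩
  obtain ⟨τ, hτ⟩ := exists_tendsto_phase (μ := μ) (lam := lam) he he' hρ₀ hPI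
    (fun t ht => (hP t ht).continuousWithinAt) hV hδ hdecay
  obtain ⟨K, hK, hK'⟩ := exists_inverse_meanAnomaly he he1
  -- The eccentric anomaly of the Keplerian motion that has the limiting phase `τ`.
  let W : ℝ → ℝ := fun t => K (μ ^ 2 / lam ^ 3 * t + τ)
  have hW : ∀ t, meanAnomaly e (W t) = μ ^ 2 / lam ^ 3 * t + τ := fun t => hK _
  have hW' : ∀ t, HasDerivAt W (μ ^ 2 / lam ^ 3 * (1 - e * Real.cos (W t))⁻¹) t := by
    intro t
    have h := (hK' (μ ^ 2 / lam ^ 3 * t + τ)).comp t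
      (((hasDerivAt_id t).const_mul (μ ^ 2 / lam ^ 3)).add_const τ)
    refine h.congr_deriv ?_
    simp only [W]
    ring
  obtain ⟨hy, hkep⟩ := kepler_motion hμ hlam he he1 τ hW hW'
  have hPlim : Tendsto P atTop (𝓝 1) := by
    have h1 : Tendsto (fun t => |ρ₀ - 1| * Real.exp (-δ * (t - t₀))) atTop (𝓝 0) := by
      rw [← mul_zero |ρ₀ - 1|]
      refine Tendsto.const_mul _ (Real.tendsto_exp_atBot.comp ?_)
      exact (tendsto_atTop_add_const_right _ (-t₀) tendsto_id).const_mul_atTop_of_neg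
        (neg_lt_zero.2 hδ)
    rw [tendsto_iff_dist_tendsto_zero]
    refine squeeze_zero' (Eventually.of_forall fun t => dist_nonneg) ?_ h1
    filter_upwards [Ici_mem_atTop t₀] with t ht
    exact hdecay t ht
  have hVW : Tendsto (fun t => V t - W t) atTop (𝓝 0) := by
    have h1 : Tendsto (fun t => |meanAnomaly e (V t) - μ ^ 2 / lam ^ 3 * t - τ| / (1 - e))
        atTop (𝓝 0) := by
      simpa using ((hτ.sub_const τ).abs.div_const (1 - e))
    rw [tendsto_zero_iff_abs_tendsto_zero]
    refine squeeze_zero (fun t => abs_nonneg _) (fun t => ?_) h1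
    rw [Function.comp_apply, le_div_iff₀ (by linarith), mul_comm]
    refine (mul_abs_sub_le_abs_meanAnomaly_sub he _ _).trans_eq ?_
    rw [hW, sub_sub]
  have hPI' : ∀ᶠ t in atTop, P t ∈ uIcc 1 ρ₀ := by
    filter_upwards [Ici_mem_atTop t₀] with t ht using hPI t ht
  have hΦ := continuousOn_ellipticPoint (semiMajor μ lam) he hIe
  have hbΦ : ContinuousOn (fun p : ℝ × ℝ =>
      drift μ lam e (ellipticPoint (semiMajor μ lam) e p.1 p.2)) (uIcc 1 ρ₀ ×ˢ univ) :=
    fun p hp => ContinuousAt.comp_continuousWithinAt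
      (f := fun p : ℝ × ℝ => ellipticPoint (semiMajor μ lam) e p.1 p.2)
      (contDiffAt_drift hμ hlam he he1 (hIe _ hp.1)).continuousAt (hΦ p hp)
  have hper := periodic_ellipticPoint (semiMajor μ lam) e
  refine ⟨_, hy, hkep, tendsto_dist_of_periodic isCompact_uIcc hΦ hper left_mem_uIcc hPI' hPlim hVW,
    (tendsto_dist_of_periodic isCompact_uIcc hbΦ (fun ρ v => congrArg _ (hper ρ v)) left_mem_uIcc
      hPI' hPlim hVW).congr' ?_⟩
  -- For `t > t₀` strictly, the one-sided derivatives are two-sided, so both velocities are values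
  -- of the drift.
  filter_upwards [Ioi_mem_atTop t₀] with t ht
  rw [((hx t (Ioi_subset_Ici_self ht)).hasDerivAt (Ici_mem_nhds ht)).deriv,
    ((hy t (mem_univ t)).hasDerivAt univ_mem).deriv]

theorem SettlesToKeplerian.congr {x z : ℝ → Plane} (hx : SettlesToKeplerian μ lam e x)
    (h : EqOn z x (Ici t₀)) : SettlesToKeplerian μ lam e z := by
  obtain ⟨y, hy, hkep, h0, h1⟩ := hx
  refine ⟨y, hy, hkep, h0.congr' ?_, h1.congr' ?_⟩
  · filter_upwards [Ici_mem_atTop t₀] with t ht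
    rw [h ht]
  · filter_upwards [Ioi_mem_atTop t₀] with t ht
    rw [(h.eventuallyEq_of_mem (Ici_mem_nhds ht)).deriv_eq]

end Settle

end KeplerFlow

end

theorem mainTheorem8 (μ lam e : ℝ) (hμ : 0 < μ) (hlam : 0 < lam)
    (he : 0 < e) (he' : e < 1 / √2) (t₀ : ℝ) (x₀ : KeplerFlow.Plane)
    (hx₀ : x₀ ∈ KeplerFlow.ellipseExt (KeplerFlow.semiMajor μ lam) e (KeplerFlow.eTilde e)) :
    (∃ x : ℝ → KeplerFlow.Plane, KeplerFlow.IsOrbitOn μ lam e (Ici t₀) x ∧ x t₀ = x₀ ∧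
      (∀ t ∈ Ici t₀,
        x t ∈ KeplerFlow.ellipseExt (KeplerFlow.semiMajor μ lam) e (KeplerFlow.eTilde e)) ∧
      ∀ (T : ℝ) (y : ℝ → KeplerFlow.Plane),
        KeplerFlow.IsOrbitOn μ lam e (Ico t₀ T) y → y t₀ = x₀ → EqOn y x (Ico t₀ T)) ∧
    ∀ x : ℝ → KeplerFlow.Plane, KeplerFlow.IsOrbitOn μ lam e (Ici t₀) x → x t₀ = x₀ →
      KeplerFlow.SettlesToKeplerian μ lam e x := by
  have ha := KeplerFlow.semiMajor_pos hμ hlam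
  have he1 := KeplerFlow.lt_one_of_lt he' he
  obtain ⟨ρ₀, v₀, hρ₀, rfl⟩ := KeplerFlow.exists_eq_ellipticPoint ha he he1 x₀
  rw [KeplerFlow.ellipticPoint_mem_ellipseExt_iff ha he he' hρ₀] at hx₀
  obtain ⟨x, hx, hx0, hrep, hset⟩ :=
    KeplerFlow.exists_settling_orbit hμ hlam he he' hx₀ t₀ v₀
  have huniq : ∀ (T : ℝ) (y : ℝ → KeplerFlow.Plane), KeplerFlow.IsOrbitOn μ lam e (Ico t₀ T) y →
      y t₀ = KeplerFlow.ellipticPoint (KeplerFlow.semiMajor μ lam) e ρ₀ v₀ →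
      EqOn y x (Ico t₀ T) := by
    intro T y hy hy0
    refine KeplerFlow.eqOn_Ico_of_lipschitz_along (hx.mono Ico_subset_Ici_self) hy
      (hy0.trans hx0.symm) fun t ht => ?_
    obtain ⟨ρ, v, hρ, h⟩ := hrep t ht.1
    rw [h]
    exact (KeplerFlow.contDiffAt_drift hμ hlam he he1
      (KeplerFlow.lt_of_sqrt_two_mul_lt he hρ)).exists_lipschitzOnWith
  refine ⟨⟨x, hx, hx0, fun t ht => ?_, huniq⟩, fun z hz hz0 => ?_⟩
  · obtain ⟨ρ, v, hρ, h⟩ := hrep t ht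
    rw [h, KeplerFlow.ellipticPoint_mem_ellipseExt_iff ha he he'
      (KeplerFlow.lt_of_sqrt_two_mul_lt he hρ).le]
    exact hρ
  · refine hset.congr (t₀ := t₀) fun t ht => ?_
    -- Uniqueness is on half-open intervals, so any end point beyond `t` will do.
    exact huniq (t + 1) z (hz.mono Ico_subset_Ici_self) hz0 ⟨ht, lt_add_one t⟩
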